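/- Let $F$ be a field and let $A$ be a central division $F$-algebra (a finite-dimensional division algebra with center $F$) of degree $\deg A=\sqrt{\dim_F A}$, such that $\operatorname{char} F$ does not divide $\deg A$. Suppose $A$ contains a Galois field extension $K/F$ whose Galois group $G=\operatorname{Gal}(K/F)$ is abelian, and let $\varepsilon\colon\Gamma\to G$ be a surjective homomorphism, where $\Gamma$ is a totally ordered abelian (additive) group. Let $C_A(K)$ be the centralizer of $K$ in $A$. Then there is a family of units $(u_\sigma)_{\sigma\in G}$ of $A$ with $u_{\mathrm{Id}}=1$ and $\sigma(x)=u_\sigma^{-1}xu_\sigma$ for all $\sigma\in G$ and $x\in K$. For any such family, let $\mathcal D=C_A(K)((\Gamma))$ be the Mal'cev–Neumann ring of formal series $\sum_{\gamma\in\Gamma}a_\gamma r_\gamma$ with coefficients $r_\gamma\in C_A(K)$ and with well-ordered support $\{\gamma\in\Gamma : r_\gamma\neq0\}$, with componentwise addition and with the multiplication given by $$r\,a_\gamma=a_\gamma\,(u_{\varepsilon(\gamma)}^{-1}\,r\,u_{\varepsilon(\gamma)})\quad(r\in C_A(K)),\qquad a_\gamma a_\delta=a_{\gamma+\delta}\,u_{\varepsilon(\gamma)\varepsilon(\delta)}^{-1}u_{\varepsilon(\gamma)}u_{\varepsilon(\delta)}\quad(\gamma,\delta\in\Gamma).$$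 Let $F((\ker\varepsilon))\subseteq\mathcal D$ be the subfield of the series $\sum_{\gamma\in\ker\varepsilon}a_\gamma c_\gamma$ with all $c_\gamma\in F$. If $A$ contains no maximal subfield $M\supseteq K$ such that $M/F$ is a Galois extension, then, for every such family $(u_\sigma)$, $\mathcal D$ is a noncrossed product division algebra over $F((\ker\varepsilon))$: it is a division ring, its center is $F((\ker\varepsilon))$, it is finite-dimensional over its center, and it contains no maximal commutative subalgebra that is a Galois field extension of $F((\ker\varepsilon))$. -/

import Mathlib

section Notions

/-- The `F`-algebra `E` is a field and `E/F` is a Galois extension. -/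
def IsGaloisExtension (F E : Type*) [Field F] [Ring E] [Algebra F E] : Prop :=
  ∃ h : IsField E, @IsGalois F _ E h.toField ‹Algebra F E›

/-- `M` is maximal among the subalgebras of `A` that are fields. -/
def IsMaximalSubfield {F A : Type*} [Field F] [Ring A] [Algebra F A]
    (M : Subalgebra F A) : Prop :=
  Maximal (fun L : Subalgebra F A => IsField L) M

/-- `M` is maximal among the commutative subalgebras of `A`. -/
def IsMaximalCommutative {F A : Type*} [Field F] [Ring A] [Algebra F A]
    (M : Subalgebra F A) : Prop :=
  Maximal (fun L : Subalgebra F A => ∀ x ∈ L, ∀ y ∈ L, x * y = y * x) M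

/-- A (finite-dimensional central simple) algebra over `F` is a crossed product if it contains a
maximal commutative subalgebra that is a Galois field extension of `F`. -/
def IsCrossedProduct (F A : Type*) [Field F] [Ring A] [Algebra F A] : Prop :=
  ∃ L : Subalgebra F A, IsMaximalCommutative L ∧ IsGaloisExtension F L

/-- A noncrossed product division algebra over `F`: a finite-dimensional division algebra whose
center is `F` and which is not a crossed product. -/
structure IsNoncrossedProductDivisionAlgebra (F D : Type*) [Field F] [Ring D] [Algebra F D] :
    Prop where
  nontrivial : Nontrivial D
  isUnit_of_ne_zero : ∀ x : D, x ≠ 0 → IsUnit x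
  isCentral : Algebra.IsCentral F D
  finiteDimensional : FiniteDimensional F D
  not_isCrossedProduct : ¬ IsCrossedProduct F D

/-- The degree of a finite-dimensional central simple algebra: the square root of its dimension
(which is a perfect square). -/
noncomputable def algebraDegree (F A : Type*) [Field F] [Ring A] [Algebra F A] : ℕ :=
  Nat.sqrt (Module.finrank F A)

end Notions

section MalcevNeumann

variable {F A K Γ : Type*} [Field F] [Ring A] [Algebra F A] [Field K] [Algebra F K]

/-- A choice of units `u σ` of `A`, for `σ ∈ Gal(K/F)`, such that conjugation by `u σ` induces `σ`
on the copy `ι(K)` of `K` in `A`, with `u 1 = 1`. -/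
structure ConjugatingUnits (ι : K →ₐ[F] A) where
  u : Gal(K/F) → Aˣ
  conj : ∀ (σ : Gal(K/F)) (x : K), ι (σ x) = ((u σ)⁻¹ : Aˣ) * ι x * u σ
  u_one : u 1 = 1

/-- The centralizer `C_A(K)` of the copy `ι(K)` of `K` in `A`. -/
abbrev fieldCentralizer (ι : K →ₐ[F] A) : Subalgebra F A :=
  Subalgebra.centralizer F (ι.range : Set A)

theorem mem_fieldCentralizer_iff {ι : K →ₐ[F] A} {a : A} :
    a ∈ fieldCentralizer ι ↔ ∀ x : K, ι x * a = a * ι x := by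
  simp [fieldCentralizer, Subalgebra.mem_centralizer_iff]

namespace ConjugatingUnits

variable {ι : K →ₐ[F] A} (U : ConjugatingUnits ι)

theorem comm (σ : Gal(K/F)) (x : K) : (U.u σ : A) * ι (σ x) = ι x * U.u σ := by
  rw [U.conj, ← mul_assoc, ← mul_assoc, Units.mul_inv, one_mul]

theorem inv_comm (σ : Gal(K/F)) (x : K) :
    ι (σ x) * ((U.u σ)⁻¹ : Aˣ) = ((U.u σ)⁻¹ : Aˣ) * ι x := by
  rw [U.conj, mul_assoc, Units.mul_inv, mul_one]

/-- The map `r ↦ u_σ⁻¹ r u_σ` on `C_A(K)`. -/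
def twist (σ : Gal(K/F)) (r : fieldCentralizer ι) : fieldCentralizer ι :=
  ⟨((U.u σ)⁻¹ : Aˣ) * r * U.u σ, mem_fieldCentralizer_iff.2 fun x => by
    obtain ⟨y, rfl⟩ := σ.surjective x
    have h := mem_fieldCentralizer_iff.1 r.2 y
    rw [← mul_assoc, ← mul_assoc, U.inv_comm, mul_assoc _ (U.u σ : A), U.comm,
      mul_assoc _ (ι y), h]
    simp only [mul_assoc]⟩

variable [IsMulCommutative Gal(K/F)]

/-- The element `u_{στ}⁻¹ u_σ u_τ` of `C_A(K)`. -/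
def cocycle (σ τ : Gal(K/F)) : fieldCentralizer ι :=
  ⟨((U.u (σ * τ))⁻¹ : Aˣ) * U.u σ * U.u τ, mem_fieldCentralizer_iff.2 fun x => by
    obtain ⟨y, rfl⟩ := (σ * τ).surjective x
    have hst : (σ * τ) y = τ (σ y) := by
      rw [show σ * τ = τ * σ from IsMulCommutative.is_comm.comm σ τ]; rfl
    calc ι ((σ * τ) y) * (((U.u (σ * τ))⁻¹ : Aˣ) * U.u σ * U.u τ)
        = ((U.u (σ * τ))⁻¹ : Aˣ) * (ι y * U.u σ) * U.u τ := by
          rw [← mul_assoc, ← mul_assoc, U.inv_comm, mul_assoc _ (ι y)]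
      _ = ((U.u (σ * τ))⁻¹ : Aˣ) * U.u σ * U.u τ * ι ((σ * τ) y) := by
          rw [← U.comm σ, ← mul_assoc, mul_assoc _ (ι (σ y)), ← U.comm τ, hst]
          simp only [mul_assoc]⟩

end ConjugatingUnits

variable [AddCommGroup Γ] [LinearOrder Γ]

/-- The Mal'cev-Neumann ring `C_A(K)((Γ))`: formal series `∑ a_γ r_γ` with coefficients `r_γ` in
`C_A(K)` and with well-ordered support in `Γ`. The field `series` is the family of coefficients
`r_γ` (in Mathlib, the support of a Hahn series is required to be partially well-ordered, which
for a linear order is the same as well-ordered); the multiplication is defined below and is not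
the one of Hahn series. -/
@[ext]
structure MalcevNeumann {ι : K →ₐ[F] A} (U : ConjugatingUnits ι)
    (ε : Γ →+ Additive Gal(K/F)) where
  series : HahnSeries Γ (fieldCentralizer ι)

namespace MalcevNeumann

variable {ι : K →ₐ[F] A} {U : ConjugatingUnits ι} {ε : Γ →+ Additive Gal(K/F)}

instance : Zero (MalcevNeumann U ε) := ⟨⟨0⟩⟩

noncomputable instance : One (MalcevNeumann U ε) := ⟨⟨HahnSeries.single 0 1⟩⟩

instance : Add (MalcevNeumann U ε) := ⟨fun x y => ⟨x.series + y.series⟩⟩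

instance : Neg (MalcevNeumann U ε) := ⟨fun x => ⟨-x.series⟩⟩

/-- The series `∑ a_γ r_γ` as the Hahn series over `A` with coefficients `u_{ε(γ)} r_γ`; this is
an injective ring homomorphism, from which the ring axioms are deduced. -/
def toHahn (x : MalcevNeumann U ε) : HahnSeries Γ A where
  coeff γ := U.u (ε γ).toMul * (x.series.coeff γ : A)
  isPWO_support' := x.series.isPWO_support.mono fun γ hγ h => hγ (by simp [h])

theorem coeff_toHahn (x : MalcevNeumann U ε) (γ : Γ) :
    x.toHahn.coeff γ = U.u (ε γ).toMul * (x.series.coeff γ : A) := rfl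

theorem support_toHahn (x : MalcevNeumann U ε) : x.toHahn.support = x.series.support := by
  ext γ
  simp [HahnSeries.mem_support, coeff_toHahn]

theorem toHahn_injective : Function.Injective (toHahn : MalcevNeumann U ε → HahnSeries Γ A) := by
  intro x y h
  ext γ
  have := congrArg (fun z => z.coeff γ) h
  simpa [coeff_toHahn] using this

theorem toHahn_zero : (0 : MalcevNeumann U ε).toHahn = 0 := by
  ext γ
  rw [coeff_toHahn]
  change _ * (((0 : HahnSeries Γ (fieldCentralizer ι)).coeff γ : fieldCentralizer ι) : A) = _
  simp

theorem toHahn_one : (1 : MalcevNeumann U ε).toHahn = 1 := by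
  ext γ
  rw [coeff_toHahn, HahnSeries.coeff_one]
  change _ * (((1 : HahnSeries Γ (fieldCentralizer ι)).coeff γ : fieldCentralizer ι) : A) = _
  rw [HahnSeries.coeff_one]
  split_ifs with h
  · simp [h, U.u_one]
  · simp

theorem toHahn_add (x y : MalcevNeumann U ε) : (x + y).toHahn = x.toHahn + y.toHahn := by
  ext γ
  rw [HahnSeries.coeff_add, coeff_toHahn, coeff_toHahn, coeff_toHahn, ← mul_add]
  rfl

theorem toHahn_neg (x : MalcevNeumann U ε) : (-x).toHahn = -x.toHahn := by
  ext γ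
  rw [HahnSeries.coeff_neg, coeff_toHahn, coeff_toHahn, ← mul_neg]
  rfl

variable (U ε) in
/-- The map `F((ker ε)) → C_A(K)((Γ))`, `∑ c_γ t^γ ↦ ∑ a_γ c_γ`, where `F((ker ε))` is the field
of Hahn series over `F` with exponents in `ker ε`. -/
noncomputable def ofKer (f : HahnSeries ε.ker F) : MalcevNeumann U ε :=
  ⟨HahnSeries.embDomain (OrderEmbedding.subtype (· ∈ ε.ker))
    (f.map (algebraMap F (fieldCentralizer ι)))⟩

theorem coeff_ofKer (f : HahnSeries ε.ker F) (γ : ε.ker) :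
    (ofKer U ε f).series.coeff γ = algebraMap F (fieldCentralizer ι) (f.coeff γ) :=
  HahnSeries.embDomain_coeff (f := OrderEmbedding.subtype (· ∈ ε.ker))

theorem coeff_ofKer_of_notMem (f : HahnSeries ε.ker F) {γ : Γ} (hγ : γ ∉ ε.ker) :
    (ofKer U ε f).series.coeff γ = 0 :=
  HahnSeries.embDomain_of_notMem_range (by rintro ⟨δ, rfl⟩; exact hγ δ.2)

theorem coeff_toHahn_ofKer_commute (f : HahnSeries ε.ker F) (γ : Γ) (a : A) :
    (ofKer U ε f).toHahn.coeff γ * a = a * (ofKer U ε f).toHahn.coeff γ := by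
  rw [coeff_toHahn]
  by_cases hγ : γ ∈ ε.ker
  · have h1 := coeff_ofKer (U := U) f ⟨γ, hγ⟩
    dsimp only at h1
    rw [h1, AddMonoidHom.mem_ker.1 hγ, toMul_zero, U.u_one, Units.val_one, one_mul]
    exact Algebra.commutes _ _
  · rw [coeff_ofKer_of_notMem f hγ, ZeroMemClass.coe_zero, mul_zero, zero_mul, mul_zero]

variable [IsOrderedAddMonoid Γ]

theorem toHahn_ofKer (f : HahnSeries ε.ker F) :
    (ofKer U ε f).toHahn = HahnSeries.embDomainRingHom ε.ker.subtype ε.ker.subtype_injective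
      (fun _ _ => Iff.rfl) (f.map (algebraMap F A)) := by
  ext γ
  rw [coeff_toHahn]
  by_cases hγ : γ ∈ ε.ker
  · have h1 := coeff_ofKer (U := U) f ⟨γ, hγ⟩
    have h2 : (HahnSeries.embDomainRingHom ε.ker.subtype ε.ker.subtype_injective
        (fun _ _ => Iff.rfl) (f.map (algebraMap F A))).coeff γ = algebraMap F A (f.coeff ⟨γ, hγ⟩) :=
      HahnSeries.embDomain_coeff (f := OrderEmbedding.subtype (· ∈ ε.ker)) (a := ⟨γ, hγ⟩)
    dsimp only at h1
    rw [h1, h2, AddMonoidHom.mem_ker.1 hγ, toMul_zero, U.u_one, Units.val_one, one_mul]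
    rfl
  · rw [coeff_ofKer_of_notMem f hγ, ZeroMemClass.coe_zero, mul_zero]
    exact (HahnSeries.embDomain_of_notMem_range (f := OrderEmbedding.subtype (· ∈ ε.ker))
      (by rintro ⟨δ, rfl⟩; exact hγ δ.2)).symm

theorem toHahn_ofKer_commute (f : HahnSeries ε.ker F) (y : HahnSeries Γ A) :
    (ofKer U ε f).toHahn * y = y * (ofKer U ε f).toHahn := by
  ext g
  rw [HahnSeries.coeff_mul, HahnSeries.coeff_mul]
  refine Finset.sum_equiv (Equiv.prodComm _ _) (fun p => ?_) (fun p _ => ?_)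
  · simp only [Finset.mem_antidiagonal, Equiv.prodComm_apply, Prod.fst_swap, Prod.snd_swap,
      add_comm p.2]
    tauto
  · exact coeff_toHahn_ofKer_commute f _ _

variable [IsMulCommutative Gal(K/F)]

/-- The coefficient of `a_g` in the product `(∑ a_γ r_γ) (∑ a_δ s_δ)`, obtained from the rules
`r a_δ = a_δ (u_{ε(δ)}⁻¹ r u_{ε(δ)})` and `a_γ a_δ = a_{γ+δ} u_{ε(γ)ε(δ)}⁻¹ u_{ε(γ)} u_{ε(δ)}`.
The sum runs over the finitely many pairs `(γ, δ)` of elements of the supports with sum `g`. -/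
noncomputable def mulCoeff (x y : MalcevNeumann U ε) (g : Γ) : fieldCentralizer ι :=
  ∑ p ∈ Finset.antidiagonal x.series.isPWO_support y.series.isPWO_support g,
    U.cocycle (ε p.1).toMul (ε p.2).toMul *
      (U.twist (ε p.2).toMul (x.series.coeff p.1) * y.series.coeff p.2)

theorem u_mul_mulCoeff (x y : MalcevNeumann U ε) (g : Γ) :
    U.u (ε g).toMul * (x.mulCoeff y g : A) = (x.toHahn * y.toHahn).coeff g := by
  rw [HahnSeries.coeff_mul, mulCoeff, AddSubmonoidClass.coe_finsetSum, Finset.mul_sum]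
  have hs : Finset.antidiagonal x.toHahn.isPWO_support y.toHahn.isPWO_support g =
      Finset.antidiagonal x.series.isPWO_support y.series.isPWO_support g := by
    ext p
    simp only [Finset.mem_antidiagonal, support_toHahn]
  rw [hs]
  refine Finset.sum_congr rfl fun p hp => ?_
  have hg : ε g = ε p.1 + ε p.2 := by
    rw [← map_add, (Finset.mem_antidiagonal.1 hp).2.2]
  rw [hg, toMul_add, coeff_toHahn, coeff_toHahn]
  simp [ConjugatingUnits.cocycle, ConjugatingUnits.twist, mul_assoc]

noncomputable instance : Mul (MalcevNeumann U ε) :=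
  ⟨fun x y => ⟨{
    coeff := x.mulCoeff y
    isPWO_support' := (x.toHahn * y.toHahn).isPWO_support.mono fun g hg h => hg (by
      rw [← u_mul_mulCoeff] at h
      simpa using h) }⟩⟩

theorem coeff_mul (x y : MalcevNeumann U ε) (g : Γ) :
    (x * y).series.coeff g = x.mulCoeff y g := rfl

theorem toHahn_mul (x y : MalcevNeumann U ε) : (x * y).toHahn = x.toHahn * y.toHahn := by
  ext g
  rw [coeff_toHahn, coeff_mul, u_mul_mulCoeff]

noncomputable instance : Ring (MalcevNeumann U ε) where
  add_assoc x y z := toHahn_injective (by simp only [toHahn_add, add_assoc])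
  zero_add x := toHahn_injective (by simp only [toHahn_add, toHahn_zero, zero_add])
  add_zero x := toHahn_injective (by simp only [toHahn_add, toHahn_zero, add_zero])
  add_comm x y := toHahn_injective (by simp only [toHahn_add, add_comm])
  neg_add_cancel x :=
    toHahn_injective (by simp only [toHahn_add, toHahn_neg, toHahn_zero, neg_add_cancel])
  mul_assoc x y z := toHahn_injective (by simp only [toHahn_mul, mul_assoc])
  one_mul x := toHahn_injective (by simp only [toHahn_mul, toHahn_one, one_mul])
  mul_one x := toHahn_injective (by simp only [toHahn_mul, toHahn_one, mul_one])
  zero_mul x := toHahn_injective (by simp only [toHahn_mul, toHahn_zero, zero_mul])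
  mul_zero x := toHahn_injective (by simp only [toHahn_mul, toHahn_zero, mul_zero])
  left_distrib x y z := toHahn_injective (by simp only [toHahn_mul, toHahn_add, mul_add])
  right_distrib x y z := toHahn_injective (by simp only [toHahn_mul, toHahn_add, add_mul])
  nsmul := nsmulRec
  zsmul := zsmulRec

/-- `C_A(K)((Γ))` as an algebra over its subfield `F((ker ε))`. -/
noncomputable instance : Algebra (HahnSeries ε.ker F) (MalcevNeumann U ε) :=
  RingHom.toAlgebra'
    { toFun := ofKer U ε
      map_one' := toHahn_injective (by
        rw [toHahn_ofKer, toHahn_one]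
        exact (congrArg _ (HahnSeries.map_one (algebraMap F A).toMonoidWithZeroHom)).trans (map_one _))
      map_mul' := fun f g => toHahn_injective (by
        rw [toHahn_mul, toHahn_ofKer, toHahn_ofKer, toHahn_ofKer, ← map_mul]
        exact congrArg _ (HahnSeries.map_mul (algebraMap F A : F →ₙ+* A)))
      map_zero' := toHahn_injective (by
        rw [toHahn_ofKer, toHahn_zero]
        exact (congrArg _ (HahnSeries.map_zero (algebraMap F A : ZeroHom F A))).trans (map_zero _))
      map_add' := fun f g => toHahn_injective (by
        rw [toHahn_add, toHahn_ofKer, toHahn_ofKer, toHahn_ofKer, ← map_add]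
        exact congrArg _ (HahnSeries.map_add (algebraMap F A : F →+ A))) }
    (fun f y => toHahn_injective (by
      rw [toHahn_mul, toHahn_mul]
      exact toHahn_ofKer_commute f y.toHahn))

theorem algebraMap_eq_ofKer (f : HahnSeries ε.ker F) :
    algebraMap (HahnSeries ε.ker F) (MalcevNeumann U ε) f = ofKer U ε f := rfl

end MalcevNeumann

end MalcevNeumann

/-! Write Z for F((ker ε)) and D for the Mal'cev-Neumann ring. Sending a_γ to u_{ε(γ)} t^γ with t
central embeds D in the Hahn series over A (`toHahn`). The image consists of the series whose
coefficient at γ lies in the eigenspace A_σ = {a : x a = a σ(x) for x in K}, where σ = ε(γ), and A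
is the direct sum of the A_σ. Leading coefficients are multiplicative, and those of elements of Z
lie in F. Hence elements with F-independent leading coefficients are Z-independent, which gives
[D:Z] = [A:F] (`finrank_eq`); commuting with all monomials forces a central series into Z.

Let L be a maximal commutative subalgebra of D that is Galois over Z. It is its own centralizer, so
[A:F] = [D:Z] ≤ [L:Z]². Let R be its residue field, the constant coefficients of its elements of
nonnegative order; R centralizes K because ε(0) = 1. By Skolem-Noether the automorphisms of L are
conjugations in D, so they preserve the order, and reducing characteristic polynomials shows that
R/F is normal (`normal_residueField`). Thus M = KR is a subfield of A normal over F.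

Sort the leading coefficients of L by σ = ε(order), and let S be the set of σ that occur. Two in the
same class differ by a factor in R, so [L:Z] ≤ |S|[R:F]. Each commutes with R and induces σ on K, so
conjugation gives |S| distinct R-automorphisms of M, and |S|[R:F] ≤ [M:F]. Therefore [A:F] ≤ [M:F]²,
which makes M a maximal subfield of degree deg A. The hypothesis on the characteristic makes M/F
separable, hence Galois, and M contains K: this is what was excluded. -/

/-! ### Two-sided linear relations in central division algebras -/

section TwoSidedRelations

variable {F D : Type*} [Field F] [DivisionRing D] [Algebra F D] [Algebra.IsCentral F D]

/-- The Artin-Whaples theorem: left multiplications by linearly independent elements of a central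
division algebra are linearly independent over right multiplications. -/
theorem LinearIndependent.eq_zero_of_forall_sum_mul_mul_eq_zero {ι : Type*} {v : ι → D}
    (hv : LinearIndependent F v) (s : Finset ι) (r : ι → D)
    (h : ∀ d, ∑ i ∈ s, v i * d * r i = 0) : ∀ i ∈ s, r i = 0 := by
  classical
  induction s using Finset.induction_on generalizing r with
  | empty => simp
  | insert j s hj ih =>
    have hrj : r j = 0 := by
      by_contra hne
      -- Normalize the relation so that the coefficient of v j is 1. Comparing it at d * b with its
      -- right multiple by b cancels that term, and induction makes the remaining coefficients
      -- central.
      have h1 : ∀ d, v j * d + ∑ i ∈ s, v i * d * (r i * (r j)⁻¹) = 0 := fun d => by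
        have h2 := congrArg (· * (r j)⁻¹) (h d)
        simp only [Finset.sum_insert hj, add_mul, Finset.sum_mul, zero_mul] at h2
        rw [mul_assoc _ (r j), mul_inv_cancel₀ hne, mul_one] at h2
        simpa only [mul_assoc] using h2
      have h3 : ∀ i ∈ s, ∃ c : F, algebraMap F D c = r i * (r j)⁻¹ := by
        intro i hi
        have h4 : r i * (r j)⁻¹ ∈ Subalgebra.center F D := by
          rw [Subalgebra.mem_center_iff]
          intro b
          refine sub_eq_zero.1 (ih (fun i => b * (r i * (r j)⁻¹) - r i * (r j)⁻¹ * b) ?_ i hi)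
          intro d
          have h5 := h1 (d * b)
          have h6 := congrArg (· * b) (h1 d)
          simp only [add_mul, Finset.sum_mul, zero_mul] at h6
          rw [← h6] at h5
          simp only [mul_assoc] at h5
          have h7 := add_left_cancel h5
          simp only [mul_sub, Finset.sum_sub_distrib, mul_assoc]
          rw [h7, sub_self]
        rw [Algebra.IsCentral.center_eq_bot] at h4
        exact Algebra.mem_bot.1 h4
      choose! c hc using h3
      have h8 := h1 1
      have h9 : ∑ i ∈ insert j s, (if i = j then 1 else c i) • v i = 0 := by
        rw [Finset.sum_insert hj, if_pos rfl, one_smul, ← h8, mul_one]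
        congr 1
        refine Finset.sum_congr rfl fun i hi => ?_
        rw [if_neg (ne_of_mem_of_not_mem hi hj), mul_one, ← hc i hi, Algebra.smul_def,
          Algebra.commutes]
      have h10 := linearIndependent_iff'.1 hv _ _ h9 j (Finset.mem_insert_self _ _)
      simp at h10
    intro i hi
    rcases Finset.mem_insert.1 hi with rfl | hi
    · exact hrj
    · refine ih r (fun d => ?_) i hi
      simpa [Finset.sum_insert hj, hrj] using h d

/-- A commutative subfield of a central division algebra has degree at most the degree of the
algebra. -/
theorem finrank_sq_le_of_algHom {L : Type*} [Field L] [Algebra F L] [FiniteDimensional F D]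
    (ι : L →ₐ[F] D) : Module.finrank F L ^ 2 ≤ Module.finrank F D := by
  have : FiniteDimensional F L :=
    FiniteDimensional.of_injective ι.toLinearMap ι.toRingHom.injective
  let : Module L D := Module.compHom D ι.toRingHom
  have hsmul : ∀ (l : L) (d : D), l • d = ι l * d := fun _ _ => rfl
  have : IsScalarTower F L D := ⟨fun a l d => by
    rw [hsmul, hsmul, map_smul, smul_mul_assoc]⟩
  have : FiniteDimensional L D := FiniteDimensional.right F L D
  let b := Module.finBasis F L
  let x := Module.finBasis L D
  -- With n = [L:F] and m = [D:L], this is a map D^n → D^m. As L is commutative, a relation that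
  -- holds at the L-basis x holds at every d, so the map is injective by Artin-Whaples. Thus n ≤ m,
  -- while n * m = [D:F].
  let φ : (Fin (Module.finrank F L) → D) →ₗ[F] (Fin (Module.finrank L D) → D) :=
    { toFun := fun a j => ∑ i, ι (b i) * x j * a i
      map_add' := fun a a' => by ext j; simp [mul_add, Finset.sum_add_distrib]
      map_smul' := fun c a => by ext j; simp [Finset.smul_sum] }
  have hφ : Function.Injective φ := by
    rw [← LinearMap.ker_eq_bot, LinearMap.ker_eq_bot']
    intro a ha
    have hb : LinearIndependent F fun i => ι (b i) :=
      b.linearIndependent.map' ι.toLinearMap (LinearMap.ker_eq_bot.2 ι.toRingHom.injective)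
    have h0 : ∀ d, ∑ i, ι (b i) * d * a i = 0 := by
      intro d
      rw [← x.sum_repr d]
      simp only [hsmul, Finset.mul_sum, Finset.sum_mul]
      rw [Finset.sum_comm]
      refine Finset.sum_eq_zero fun j _ => ?_
      have h1 : ∑ i, ι (b i) * x j * a i = 0 := congrFun ha j
      rw [← mul_zero (ι (x.repr d j)), ← h1, Finset.mul_sum]
      refine Finset.sum_congr rfl fun i _ => ?_
      simp only [← mul_assoc, ← map_mul, mul_comm (b i)]
    ext i
    exact hb.eq_zero_of_forall_sum_mul_mul_eq_zero Finset.univ a h0 i (Finset.mem_univ i)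
  have h2 := LinearMap.finrank_le_finrank_of_injective hφ
  have h3 := Module.finrank_mul_finrank F L D
  simp only [Module.finrank_pi_fintype, Finset.sum_const, Finset.card_univ, Fintype.card_fin,
    smul_eq_mul] at h2
  have h4 : Module.finrank F L ≤ Module.finrank L D :=
    Nat.le_of_mul_le_mul_right h2 Module.finrank_pos
  calc Module.finrank F L ^ 2 = Module.finrank F L * Module.finrank F L := sq _
    _ ≤ Module.finrank F L * Module.finrank L D := Nat.mul_le_mul_left _ h4
    _ = _ := h3

end TwoSidedRelations

/-! ### Eigenspaces of a Galois subfield -/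

section TwoSidedEval

open Polynomial

variable {F D L : Type*} [Field F] [Ring D] [Algebra F D] [Field L] [Algebra F L]

/-- The action of a commutative subring by right multiplications. -/
def AlgHom.mulRightHom (ι : L →ₐ[F] D) : L →+* Module.End F D where
  toFun l := LinearMap.mulRight F (ι l)
  map_one' := by ext; simp
  map_mul' x y := by ext; simp [mul_comm x y, mul_assoc]
  map_zero' := by ext; simp
  map_add' x y := by ext; simp [mul_add]

/-- The action of `L[X]` on `D` in which `X` acts by left multiplication by `θ` and `L` acts by
right multiplications. -/
noncomputable def AlgHom.twoSidedEval (ι : L →ₐ[F] D) (θ : D) : L[X] →+* Module.End F D :=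
  eval₂RingHom' ι.mulRightHom (LinearMap.mulLeft F θ) fun l => by
    ext d
    simp [AlgHom.mulRightHom, mul_assoc]

theorem AlgHom.twoSidedEval_apply (ι : L →ₐ[F] D) (θ : D) (q : L[X]) (d : D) :
    ι.twoSidedEval θ q d = ∑ i ∈ Finset.range (q.natDegree + 1), θ ^ i * d * ι (q.coeff i) := by
  change eval₂ ι.mulRightHom (LinearMap.mulLeft F θ) q d = _
  rw [eval₂_eq_sum_range, LinearMap.sum_apply]
  refine Finset.sum_congr rfl fun i _ => ?_
  rw [LinearMap.pow_mulLeft]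
  simp [AlgHom.mulRightHom]

/-- On an eigenvector, left multiplication by θ is right multiplication by `ι l`, so polynomials act
through their value at l. Lagrange polynomials therefore separate eigenvectors. -/
theorem AlgHom.twoSidedEval_of_comm (ι : L →ₐ[F] D) {θ a : D} {l : L} (h : θ * a = a * ι l)
    (q : L[X]) : ι.twoSidedEval θ q a = a * ι (q.eval l) := by
  have hp : ∀ i : ℕ, θ ^ i * a = a * ι l ^ i := by
    intro i
    induction i with
    | zero => simp
    | succ i ih => rw [pow_succ', mul_assoc, ih, ← mul_assoc, h, mul_assoc, ← pow_succ']
  rw [AlgHom.twoSidedEval_apply, eval_eq_sum_range, map_sum, Finset.mul_sum]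
  refine Finset.sum_congr rfl fun i _ => ?_
  rw [hp, mul_assoc, ← map_pow, ← map_mul, mul_comm]

theorem AlgHom.twoSidedEval_map (ι : L →ₐ[F] D) (θ : D) (p : F[X]) (d : D) :
    ι.twoSidedEval θ (p.map (algebraMap F L)) d = aeval θ p * d := by
  rw [AlgHom.twoSidedEval_apply, natDegree_map, aeval_eq_sum_range, Finset.sum_mul]
  refine Finset.sum_congr rfl fun i _ => ?_
  rw [coeff_map, ι.commutes, ← Algebra.commutes, Algebra.smul_def, mul_assoc]

end TwoSidedEval

section GaloisSubfield

open Polynomial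
open scoped Classical

variable {F D L : Type*} [Field F] [Field L] [Algebra F L] [FiniteDimensional F L] [IsGalois F L]

variable (F L) in
/-- A generator of a finite Galois extension. -/
noncomputable def galoisGenerator : L := (Field.powerBasisOfFiniteOfSeparable F L).gen

theorem galoisGenerator_conj_injective :
    Function.Injective fun σ : Gal(L/F) => σ (galoisGenerator F L) := by
  intro σ τ h
  have := (Field.powerBasisOfFiniteOfSeparable F L).algHom_ext (f := σ.toAlgHom)
    (g := τ.toAlgHom) h
  ext x
  exact DFunLike.congr_fun this x

variable [Ring D] [Algebra F D]

/-- Every x is p(θ) with p over F. Such a p acts on a both as left multiplication by p(θ) and, a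
being an eigenvector, as right multiplication by p(σ θ). -/
theorem comm_of_comm_galoisGenerator (ι : L →ₐ[F] D) {σ : Gal(L/F)} {a : D}
    (h : ι (galoisGenerator F L) * a = a * ι (σ (galoisGenerator F L))) (x : L) :
    ι x * a = a * ι (σ x) := by
  obtain ⟨p, rfl⟩ := (Field.powerBasisOfFiniteOfSeparable F L).exists_eq_aeval' x
  change ι (aeval (galoisGenerator F L) p) * a = a * ι (σ (aeval (galoisGenerator F L) p))
  rw [← aeval_algHom_apply ι, ← ι.twoSidedEval_map, AlgHom.twoSidedEval_of_comm ι h,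
    eval_map_algebraMap, aeval_algHom_apply]

/-- The polynomial that is `1` at the conjugate `σ θ` of the generator and `0` at the others. -/
noncomputable def galoisIdempotent (σ : Gal(L/F)) : L[X] :=
  Lagrange.basis Finset.univ (fun τ : Gal(L/F) => τ (galoisGenerator F L)) σ

theorem eval_galoisIdempotent_self (σ : Gal(L/F)) :
    (galoisIdempotent σ).eval (σ (galoisGenerator F L)) = 1 :=
  Lagrange.eval_basis_self galoisGenerator_conj_injective.injOn (Finset.mem_univ _)

theorem eval_galoisIdempotent_of_ne {σ τ : Gal(L/F)} (h : τ ≠ σ) :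
    (galoisIdempotent σ).eval (τ (galoisGenerator F L)) = 0 :=
  Lagrange.eval_basis_of_ne (v := fun τ : Gal(L/F) => τ (galoisGenerator F L)) h.symm
    (Finset.mem_univ _)

/-- The product is the characteristic polynomial of θ, so its coefficients lie in F and it acts as
left multiplication by its value at θ, which is 0. -/
theorem twoSidedEval_nodal (ι : L →ₐ[F] D) :
    ι.twoSidedEval (ι (galoisGenerator F L))
      (∏ σ : Gal(L/F), (X - C (σ (galoisGenerator F L)))) = 0 := by
  have h := Algebra.IsInvariant.charpoly_mem_lifts F L Gal(L/F) (galoisGenerator F L)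
  obtain ⟨p, hp⟩ := h
  have hp' : p.map (algebraMap F L) = ∏ σ : Gal(L/F), (X - C (σ (galoisGenerator F L))) := by
    rw [← coe_mapRingHom]
    exact hp
  have h0 : aeval (galoisGenerator F L) p = 0 := by
    rw [← eval_map_algebraMap, hp', eval_prod]
    exact Finset.prod_eq_zero (Finset.mem_univ 1) (by simp)
  ext d
  rw [← hp', ι.twoSidedEval_map, aeval_algHom_apply, h0]
  simp

/-- The Lagrange polynomial projects onto the eigenspace of σ: multiplied by X - σ θ it vanishes at
all conjugates of θ, so it is a multiple of the polynomial that acts as zero. -/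
theorem comm_twoSidedEval_galoisIdempotent (ι : L →ₐ[F] D) (σ : Gal(L/F)) (a : D) (x : L) :
    ι x * ι.twoSidedEval (ι (galoisGenerator F L)) (galoisIdempotent σ) a =
      ι.twoSidedEval (ι (galoisGenerator F L)) (galoisIdempotent σ) a * ι (σ x) := by
  refine comm_of_comm_galoisGenerator ι ?_ x
  have hdvd : ∏ τ : Gal(L/F), (X - C (τ (galoisGenerator F L))) ∣
      (X - C (σ (galoisGenerator F L))) * galoisIdempotent σ := by
    refine Finset.prod_dvd_of_coprime
      (fun τ _ τ' _ h => pairwise_coprime_X_sub_C galoisGenerator_conj_injective h) fun τ _ => ?_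
    rw [dvd_iff_isRoot, IsRoot.def, eval_mul]
    rcases eq_or_ne τ σ with rfl | h
    · simp
    · rw [eval_galoisIdempotent_of_ne h, mul_zero]
  obtain ⟨q, hq⟩ := hdvd
  have h := congrArg (ι.twoSidedEval (ι (galoisGenerator F L))) hq
  rw [map_mul, map_mul, twoSidedEval_nodal, zero_mul, map_sub, sub_mul] at h
  have h2 := sub_eq_zero.1 (DFunLike.congr_fun h a)
  simpa [AlgHom.twoSidedEval, AlgHom.mulRightHom] using h2

/-- An algebra containing a Galois extension is the sum of its eigenspaces. -/
theorem exists_sum_galois_eigenvectors (ι : L →ₐ[F] D) (a : D) :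
    ∃ f : Gal(L/F) → D, ∑ σ, f σ = a ∧ ∀ σ x, ι x * f σ = f σ * ι (σ x) := by
  refine ⟨fun σ => ι.twoSidedEval (ι (galoisGenerator F L)) (galoisIdempotent σ) a, ?_,
    fun σ => comm_twoSidedEval_galoisIdempotent ι σ a⟩
  rw [← LinearMap.sum_apply, ← map_sum]
  unfold galoisIdempotent
  rw [Lagrange.sum_basis galoisGenerator_conj_injective.injOn ⟨1, Finset.mem_univ _⟩, map_one]
  rfl

theorem galois_eigenvectors_eq_zero_of_sum (ι : L →ₐ[F] D) {f : Gal(L/F) → D}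
    (hf : ∀ σ x, ι x * f σ = f σ * ι (σ x)) (h : ∑ σ, f σ = 0) (σ : Gal(L/F)) : f σ = 0 := by
  have h1 := congrArg (ι.twoSidedEval (ι (galoisGenerator F L)) (galoisIdempotent σ)) h
  rw [map_sum, map_zero, Finset.sum_eq_single σ] at h1
  · rwa [AlgHom.twoSidedEval_of_comm ι (hf σ _), eval_galoisIdempotent_self, map_one, mul_one] at h1
  · intro τ _ hτ
    rw [AlgHom.twoSidedEval_of_comm ι (hf τ _), eval_galoisIdempotent_of_ne hτ, map_zero, mul_zero]
  · simp

end GaloisSubfield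

/-! ### Skolem-Noether and self-centralizing Galois subfields -/

section SkolemNoether

open Polynomial
open scoped Classical

variable {F D L : Type*} [Field F] [Field L] [Algebra F L] [FiniteDimensional F L] [IsGalois F L]
  [DivisionRing D] [Algebra F D]

/-- The Skolem-Noether theorem for Galois subfields of central division algebras. -/
theorem exists_unit_conj_eq [Algebra.IsCentral F D] (ι : L →ₐ[F] D) (σ : Gal(L/F)) :
    ∃ u : Dˣ, ∀ x, ι (σ x) = (u⁻¹ : Dˣ) * ι x * u := by
  let θ := galoisGenerator F L
  -- If the projector onto the eigenspace of σ were zero, it would be a two-sided relation among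
  -- independent powers of θ, and Artin-Whaples would kill its leading coefficient. A nonzero value
  -- of the projector is the required unit.
  have hne : ι.twoSidedEval (ι θ) (galoisIdempotent σ) ≠ 0 := by
    intro h0
    have hli : LinearIndependent F
        fun i : Fin (Field.powerBasisOfFiniteOfSeparable F L).dim => ι θ ^ (i : ℕ) := by
      have h1 := (Field.powerBasisOfFiniteOfSeparable F L).basis.linearIndependent.map'
        ι.toLinearMap (LinearMap.ker_eq_bot.2 ι.toRingHom.injective)
      have h1' : (fun i : Fin (Field.powerBasisOfFiniteOfSeparable F L).dim => ι θ ^ (i : ℕ)) =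
          ι.toLinearMap ∘ (Field.powerBasisOfFiniteOfSeparable F L).basis := by
        ext i
        simp [θ, galoisGenerator]
      rw [h1']
      exact h1
    have hdim : (galoisIdempotent σ).natDegree + 1 =
        (Field.powerBasisOfFiniteOfSeparable F L).dim := by
      rw [galoisIdempotent, Lagrange.natDegree_basis galoisGenerator_conj_injective.injOn
        (Finset.mem_univ _), ← PowerBasis.finrank, ← IsGalois.card_aut_eq_finrank F L,
        Nat.card_eq_fintype_card, Finset.card_univ]
      exact Nat.sub_add_cancel Fintype.card_pos
    have h2 : ∀ d, ∑ i : Fin (Field.powerBasisOfFiniteOfSeparable F L).dim,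
        ι θ ^ (i : ℕ) * d * ι ((galoisIdempotent σ).coeff i) = 0 := by
      intro d
      have h3 := DFunLike.congr_fun h0 d
      rw [AlgHom.twoSidedEval_apply, hdim, Finset.sum_range] at h3
      exact h3
    have h4 := hli.eq_zero_of_forall_sum_mul_mul_eq_zero Finset.univ _ h2
      ⟨(galoisIdempotent σ).natDegree, by omega⟩ (Finset.mem_univ _)
    have h5 : galoisIdempotent σ = 0 := by
      rw [← leadingCoeff_eq_zero]
      exact ι.toRingHom.injective (h4.trans (map_zero ι).symm)
    exact Lagrange.basis_ne_zero galoisGenerator_conj_injective.injOn (Finset.mem_univ σ) h5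
  obtain ⟨a, ha⟩ : ∃ a, ι.twoSidedEval (ι θ) (galoisIdempotent σ) a ≠ 0 := by
    by_contra! h
    exact hne (LinearMap.ext h)
  refine ⟨Units.mk0 _ ha, fun x => ?_⟩
  rw [mul_assoc, Units.val_mk0, comm_twoSidedEval_galoisIdempotent, ← mul_assoc]
  rw [Units.val_inv_eq_inv_val, Units.val_mk0, inv_mul_cancel₀ ha, one_mul]

/-- A central division algebra has dimension at most the square of the degree of a self-centralizing
Galois subfield. -/
theorem finrank_le_sq_of_self_centralizing (ι : L →ₐ[F] D)
    (hL : ∀ a : D, (∀ x, ι x * a = a * ι x) → a ∈ ι.range) :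
    Module.finrank F D ≤ Module.finrank F L ^ 2 := by
  -- Each eigenspace is at most one-dimensional over L: the quotient of two nonzero eigenvectors
  -- centralizes L, so it lies in L. For a zero eigenspace, u = 0 serves.
  have hsp : ∀ σ : Gal(L/F), ∃ u : D, ∀ a, (∀ x, ι x * a = a * ι (σ x)) → ∃ l, a = u * ι l := by
    intro σ
    by_cases h : ∃ u : D, u ≠ 0 ∧ ∀ x, ι x * u = u * ι (σ x)
    · obtain ⟨u, hu, hc⟩ := h
      refine ⟨u, fun a ha => ?_⟩
      have h1 : u⁻¹ * a ∈ ι.range := by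
        refine hL _ fun x => ?_
        obtain ⟨y, rfl⟩ := σ.surjective x
        have h2 : ι (σ y) * u⁻¹ = u⁻¹ * ι y := by
          rw [eq_inv_mul_iff_mul_eq₀ hu, ← mul_assoc, ← hc, mul_assoc, mul_inv_cancel₀ hu, mul_one]
        rw [← mul_assoc, h2, mul_assoc, ha, mul_assoc]
      obtain ⟨l, hl⟩ := h1
      exact ⟨l, by rw [show ι l = u⁻¹ * a from hl, mul_inv_cancel_left₀ hu]⟩
    · push Not at h
      refine ⟨0, fun a ha => ⟨0, ?_⟩⟩
      by_contra hne
      obtain ⟨x, hx⟩ := h a (by simpa using hne)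
      exact hx (ha x)
  choose u hu using hsp
  let φ : (Gal(L/F) → L) →ₗ[F] D :=
    { toFun := fun l => ∑ σ, u σ * ι (l σ)
      map_add' := fun l l' => by simp [mul_add, Finset.sum_add_distrib]
      map_smul' := fun c l => by simp [Finset.smul_sum] }
  have hφ : Function.Surjective φ := by
    intro a
    obtain ⟨f, hf, hfc⟩ := exists_sum_galois_eigenvectors ι a
    choose l hl using fun σ => hu σ (f σ) (hfc σ)
    refine ⟨l, ?_⟩
    rw [← hf]
    exact (Finset.sum_congr rfl fun σ _ => hl σ).symm
  have h := LinearMap.finrank_le_finrank_of_surjective hφ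
  rwa [Module.finrank_pi_fintype, Finset.sum_const, Finset.card_univ, ← Nat.card_eq_fintype_card,
    IsGalois.card_aut_eq_finrank, smul_eq_mul, ← sq] at h

end SkolemNoether

/-! ### Leading coefficients and independence over F((ker ε)) -/

section HahnSeriesSums

variable {F A Γ κ : Type*} [Field F] [Ring A] [Algebra F A] [LinearOrder Γ] [Zero Γ]

/-- A sum of Hahn series whose leading coefficients are multiples of linearly independent elements
has no cancellation. -/
theorem HahnSeries.leadingCoeff_sum_mem_span {p : κ → A} (hp : LinearIndependent F p)
    (s : Finset κ) (hs : s.Nonempty) (g : κ → HahnSeries Γ A) (c : κ → F)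
    (hg : ∀ i ∈ s, (g i).leadingCoeff = c i • p i) (hc : ∀ i ∈ s, c i ≠ 0) :
    ∑ i ∈ s, g i ≠ 0 ∧ (∑ i ∈ s, g i).leadingCoeff ∈ Submodule.span F (p '' s) := by
  classical
  obtain ⟨j, hj, hmin⟩ := s.exists_min_image (fun i => (g i).order) hs
  -- At the smallest order among the summands only leading coefficients contribute, and the
  -- independence of p prevents them from cancelling.
  have hcoeff : (∑ i ∈ s, g i).coeff (g j).order =
      ∑ i ∈ s, (if (g i).order = (g j).order then c i else 0) • p i := by
    rw [HahnSeries.coeff_sum]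
    refine Finset.sum_congr rfl fun i hi => ?_
    split_ifs with h
    · rw [← hg i hi, HahnSeries.leadingCoeff_eq, h]
    · rw [zero_smul]
      exact HahnSeries.coeff_eq_zero_of_lt_order (lt_of_le_of_ne (hmin i hi) (Ne.symm h))
  have hne : (∑ i ∈ s, g i).coeff (g j).order ≠ 0 := by
    rw [hcoeff]
    intro h
    have := linearIndependent_iff'.1 hp s _ h j hj
    simp only [if_true] at this
    exact hc j hj this
  have hne' : ∑ i ∈ s, g i ≠ 0 := by
    intro h
    rw [h] at hne
    exact hne rfl
  have hord : (∑ i ∈ s, g i).order = (g j).order := by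
    refine le_antisymm (HahnSeries.order_le_of_coeff_ne_zero hne) ?_
    rw [HahnSeries.le_order_iff_forall hne']
    intro γ hγ
    rw [HahnSeries.coeff_sum]
    exact Finset.sum_eq_zero fun i hi =>
      HahnSeries.coeff_eq_zero_of_lt_order (lt_of_lt_of_le hγ (hmin i hi))
  refine ⟨hne', ?_⟩
  rw [HahnSeries.leadingCoeff_eq, hord, hcoeff]
  exact Submodule.sum_mem _ fun i hi => Submodule.smul_mem _ _ (Submodule.subset_span ⟨i, hi, rfl⟩)

end HahnSeriesSums

namespace MalcevNeumann

section Basic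

variable {F A K Γ : Type*} [Field F] [Ring A] [Algebra F A] [Field K] [Algebra F K]
  [AddCommGroup Γ] [LinearOrder Γ] {ι : K →ₐ[F] A} {U : ConjugatingUnits ι}
  {ε : Γ →+ Additive Gal(K/F)}

theorem comm_coeff_toHahn (x : MalcevNeumann U ε) (γ : Γ) (y : K) :
    ι y * x.toHahn.coeff γ = x.toHahn.coeff γ * ι ((ε γ).toMul y) := by
  have h := mem_fieldCentralizer_iff.1 (x.series.coeff γ).2 ((ε γ).toMul y)
  rw [coeff_toHahn, mul_assoc, ← h, ← mul_assoc, ← mul_assoc, U.comm]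

/-- Converse to `comm_coeff_toHahn`: an eigenvector for ε(γ) is u_{ε(γ)} times an element of the
centralizer, so it occurs as a coefficient at γ. -/
theorem exists_toHahn_eq_single (U : ConjugatingUnits ι) (ε : Γ →+ Additive Gal(K/F)) (γ : Γ)
    {a : A} (ha : ∀ y, ι y * a = a * ι ((ε γ).toMul y)) :
    ∃ x : MalcevNeumann U ε, x.toHahn = HahnSeries.single γ a := by
  have hc : ((U.u (ε γ).toMul)⁻¹ : Aˣ) * a ∈ fieldCentralizer ι := by
    rw [mem_fieldCentralizer_iff]
    intro y
    obtain ⟨z, rfl⟩ := (ε γ).toMul.surjective y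
    rw [← mul_assoc, U.inv_comm, mul_assoc, ha, mul_assoc]
  refine ⟨⟨HahnSeries.single γ ⟨_, hc⟩⟩, ?_⟩
  ext δ
  rw [coeff_toHahn]
  by_cases h : δ = γ
  · subst h
    simp
  · simp [HahnSeries.coeff_single_of_ne h]

theorem toHahn_eq_zero {x : MalcevNeumann U ε} : x.toHahn = 0 ↔ x = 0 :=
  ⟨fun h => toHahn_injective (h.trans toHahn_zero.symm), fun h => h ▸ toHahn_zero⟩

theorem exists_coeff_toHahn_ofKer (f : HahnSeries ε.ker F) (γ : Γ) :
    ∃ c : F, (ofKer U ε f).toHahn.coeff γ = algebraMap F A c := by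
  rw [coeff_toHahn]
  by_cases hγ : γ ∈ ε.ker
  · have h1 := coeff_ofKer (U := U) f ⟨γ, hγ⟩
    dsimp only at h1
    rw [h1, AddMonoidHom.mem_ker.1 hγ, toMul_zero, U.u_one, Units.val_one, one_mul]
    exact ⟨_, rfl⟩
  · rw [coeff_ofKer_of_notMem f hγ, ZeroMemClass.coe_zero, mul_zero]
    exact ⟨0, (map_zero _).symm⟩

theorem coeff_toHahn_ofKer (f : HahnSeries ε.ker F) (γ : ε.ker) :
    (ofKer U ε f).toHahn.coeff γ = algebraMap F A (f.coeff γ) := by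
  rw [coeff_toHahn, coeff_ofKer, AddMonoidHom.mem_ker.1 γ.2, toMul_zero, U.u_one, Units.val_one,
    one_mul]
  rfl

theorem coeff_toHahn_ofKer_of_notMem (f : HahnSeries ε.ker F) {γ : Γ} (hγ : γ ∉ ε.ker) :
    (ofKer U ε f).toHahn.coeff γ = 0 := by
  rw [coeff_toHahn, coeff_ofKer_of_notMem f hγ, ZeroMemClass.coe_zero, mul_zero]

theorem toHahn_ofKer_single (γ : ε.ker) (c : F) :
    (ofKer U ε (HahnSeries.single γ c)).toHahn = HahnSeries.single (γ : Γ) (algebraMap F A c) := by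
  classical
  ext δ
  by_cases hδ : δ ∈ ε.ker
  · have := coeff_toHahn_ofKer (U := U) (HahnSeries.single γ c) ⟨δ, hδ⟩
    dsimp only at this
    rw [this, HahnSeries.coeff_single, HahnSeries.coeff_single, apply_ite (algebraMap F A), map_zero]
    simp only [Subtype.ext_iff]
    split_ifs <;> rfl
  · rw [coeff_toHahn_ofKer_of_notMem _ hδ, HahnSeries.coeff_single_of_ne]
    rintro rfl
    exact hδ γ.2

end Basic

section Hom

variable {F A K Γ : Type*} [Field F] [Ring A] [Algebra F A] [Field K] [Algebra F K]
  [AddCommGroup Γ] [LinearOrder Γ] [IsOrderedAddMonoid Γ] [IsMulCommutative Gal(K/F)]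
  {ι : K →ₐ[F] A} {U : ConjugatingUnits ι} {ε : Γ →+ Additive Gal(K/F)}

variable (U ε) in
/-- The embedding of the Mal'cev-Neumann ring in the ring of Hahn series over `A`. -/
def toHahnHom : MalcevNeumann U ε →+* HahnSeries Γ A where
  toFun := toHahn
  map_one' := toHahn_one
  map_mul' := toHahn_mul
  map_zero' := toHahn_zero
  map_add' := toHahn_add

theorem toHahn_sum {κ : Type*} (s : Finset κ) (f : κ → MalcevNeumann U ε) :
    (∑ i ∈ s, f i).toHahn = ∑ i ∈ s, (f i).toHahn := map_sum (toHahnHom U ε) f s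

theorem toHahn_smul (f : HahnSeries ε.ker F) (x : MalcevNeumann U ε) :
    (f • x).toHahn = (ofKer U ε f).toHahn * x.toHahn := by
  rw [Algebra.smul_def, toHahn_mul, algebraMap_eq_ofKer]

theorem toHahn_single_smul (γ : ε.ker) (c : F) (x : MalcevNeumann U ε) :
    (HahnSeries.single γ c • x).toHahn =
      HahnSeries.single (γ : Γ) (algebraMap F A c) * x.toHahn := by
  rw [toHahn_smul, toHahn_ofKer_single]

theorem ofKer_eq_zero [Nontrivial A] {f : HahnSeries ε.ker F} : ofKer U ε f = 0 ↔ f = 0 := by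
  refine ⟨fun h => ?_, fun h => h ▸ map_zero (algebraMap (HahnSeries ε.ker F) (MalcevNeumann U ε))⟩
  ext γ
  have h1 := coeff_toHahn_ofKer (U := U) f γ
  rw [h, toHahn_zero, HahnSeries.coeff_zero] at h1
  exact (algebraMap F A).injective (h1.symm.trans (map_zero _).symm)

end Hom

section Division

variable {F A K Γ : Type*} [Field F] [DivisionRing A] [Algebra F A] [Field K] [Algebra F K]
  [AddCommGroup Γ] [LinearOrder Γ] [IsOrderedAddMonoid Γ] [IsMulCommutative Gal(K/F)]
  {ι : K →ₐ[F] A} {U : ConjugatingUnits ι} {ε : Γ →+ Additive Gal(K/F)}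

instance : NoZeroDivisors (MalcevNeumann U ε) :=
  toHahn_injective.noZeroDivisors toHahn toHahn_zero toHahn_mul

instance : Nontrivial (MalcevNeumann U ε) :=
  ⟨⟨0, 1, fun h => by
    have := congrArg toHahn h
    rw [toHahn_zero, toHahn_one] at this
    exact zero_ne_one this⟩⟩

instance : IsDomain (MalcevNeumann U ε) := NoZeroDivisors.to_isDomain _

/-- All coefficients of a scalar series lie in F, and leading coefficients multiply because A is a
division ring. -/
theorem exists_leadingCoeff_toHahn_smul {f : HahnSeries ε.ker F} (hf : f ≠ 0) :
    ∃ c : F, c ≠ 0 ∧ ∀ x : MalcevNeumann U ε,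
      (f • x).toHahn.leadingCoeff = c • x.toHahn.leadingCoeff := by
  obtain ⟨c, hc⟩ := exists_coeff_toHahn_ofKer (U := U) f (ofKer U ε f).toHahn.order
  rw [← HahnSeries.leadingCoeff_eq] at hc
  refine ⟨c, ?_, fun x => ?_⟩
  · rintro rfl
    rw [map_zero, HahnSeries.leadingCoeff_eq_zero, toHahn_eq_zero, ofKer_eq_zero] at hc
    exact hf hc
  · rw [toHahn_smul, HahnSeries.leadingCoeff_mul, hc, Algebra.smul_def]

theorem leadingCoeff_toHahn_sum_mem_span {κ : Type*} {b : κ → MalcevNeumann U ε}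
    (hb : LinearIndependent F fun i => (b i).toHahn.leadingCoeff) (s : Finset κ)
    (f : κ → HahnSeries ε.ker F) (h : ∃ i ∈ s, f i ≠ 0) :
    ∑ i ∈ s, f i • b i ≠ 0 ∧ (∑ i ∈ s, f i • b i).toHahn.leadingCoeff ∈
      Submodule.span F ((fun i => (b i).toHahn.leadingCoeff) '' s) := by
  classical
  have hc : ∀ i, ∃ c : F, f i ≠ 0 → c ≠ 0 ∧ ∀ x : MalcevNeumann U ε,
      (f i • x).toHahn.leadingCoeff = c • x.toHahn.leadingCoeff := fun i => by
    by_cases hi : f i = 0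
    · exact ⟨0, fun h => absurd hi h⟩
    · obtain ⟨c, hc⟩ := exists_leadingCoeff_toHahn_smul (U := U) hi
      exact ⟨c, fun _ => hc⟩
  choose c hc using hc
  have hsum : ∑ i ∈ s, f i • b i = ∑ i ∈ s with f i ≠ 0, f i • b i := by
    rw [Finset.sum_filter]
    refine Finset.sum_congr rfl fun i _ => ?_
    split_ifs with hi
    · rfl
    · rw [not_not.1 hi, zero_smul]
  obtain ⟨i₀, hi₀, hne⟩ := h
  obtain ⟨h1, h2⟩ := HahnSeries.leadingCoeff_sum_mem_span hb (s.filter fun i => f i ≠ 0)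
    ⟨i₀, Finset.mem_filter.2 ⟨hi₀, hne⟩⟩ (fun i => (f i • b i).toHahn) c
    (fun i hi => (hc i (Finset.mem_filter.1 hi).2).2 _)
    (fun i hi => (hc i (Finset.mem_filter.1 hi).2).1)
  rw [← toHahn_sum, ← hsum] at h1 h2
  refine ⟨fun h => h1 (toHahn_eq_zero.2 h), Submodule.span_mono ?_ h2⟩
  exact Set.image_mono (Finset.coe_subset.2 (Finset.filter_subset _ _))

/-- Elements with linearly independent leading coefficients are linearly independent. -/
theorem linearIndependent_of_leadingCoeff {κ : Type*} {b : κ → MalcevNeumann U ε}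
    (hb : LinearIndependent F fun i => (b i).toHahn.leadingCoeff) :
    LinearIndependent (HahnSeries ε.ker F) b := by
  rw [linearIndependent_iff']
  intro s f h0 i hi
  by_contra hne
  exact (leadingCoeff_toHahn_sum_mem_span hb s f ⟨i, hi, hne⟩).1 h0

end Division

end MalcevNeumann

theorem Set.IsPWO.preimage_of_le {α β : Type*} [Preorder α] [Preorder β] {s : Set β} (hs : s.IsPWO)
    {f : α → β} (hf : ∀ x y, f x ≤ f y → x ≤ y) : (f ⁻¹' s).IsPWO := by
  intro u
  obtain ⟨m, n, hmn, h⟩ := hs (fun n => ⟨f (u n), (u n).2⟩)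
  exact ⟨m, n, hmn, hf _ _ h⟩

theorem HahnSeries.exists_coeff_eq_of_notMem {R Γ Γ' : Type*} [Zero R] [Preorder Γ]
    [PartialOrder Γ'] {g : Γ' → R} {f : Γ' → Γ} (hf : ∀ x y, f x ≤ f y → x ≤ y) {s : Set Γ}
    (hs : s.IsPWO) (h : ∀ x, f x ∉ s → g x = 0) : ∃ y : HahnSeries Γ' R, ∀ x, y.coeff x = g x :=
  ⟨⟨g, (hs.preimage_of_le hf).mono fun x hx => by_contra fun h' => hx (h x h')⟩, fun _ => rfl⟩

/-! ### Center and dimension of the Mal'cev-Neumann ring -/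

section GaloisGrading

variable {F A K : Type*} [Field F] [DivisionRing A] [Algebra F A] [Field K] [Algebra F K]
  {ι : K →ₐ[F] A}

theorem ConjugatingUnits.comm_mul_coe (U : ConjugatingUnits ι) (σ : Gal(K/F))
    (c : fieldCentralizer ι) (y : K) : ι y * (U.u σ * c) = U.u σ * (c : A) * ι (σ y) := by
  rw [← mul_assoc, ← U.comm, mul_assoc, mul_assoc, mem_fieldCentralizer_iff.1 c.2]

/-- The subspaces u_σ C_A(K) lie in the eigenspaces of the different σ, so their sum is direct. -/
theorem ConjugatingUnits.card_mul_finrank_le [FiniteDimensional F K] [IsGalois F K]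
    [FiniteDimensional F A] (U : ConjugatingUnits ι) :
    Fintype.card Gal(K/F) * Module.finrank F (fieldCentralizer ι) ≤ Module.finrank F A := by
  let φ : (Gal(K/F) → fieldCentralizer ι) →ₗ[F] A :=
    { toFun := fun c => ∑ σ, U.u σ * (c σ : A)
      map_add' := fun c c' => by simp [mul_add, Finset.sum_add_distrib]
      map_smul' := fun a c => by simp [Finset.smul_sum] }
  have hφ : Function.Injective φ := by
    rw [← LinearMap.ker_eq_bot, LinearMap.ker_eq_bot']
    intro c hc
    ext σ
    have := galois_eigenvectors_eq_zero_of_sum ι (f := fun σ => U.u σ * (c σ : A))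
      (fun σ y => U.comm_mul_coe σ (c σ) y) hc σ
    simpa using this
  have h := LinearMap.finrank_le_finrank_of_injective hφ
  rwa [Module.finrank_pi_fintype, Finset.sum_const, Finset.card_univ, smul_eq_mul] at h

end GaloisGrading

namespace MalcevNeumann

variable {F A K Γ : Type*} [Field F] [DivisionRing A] [Algebra F A]
  [Field K] [Algebra F K] [FiniteDimensional F K] [AddCommGroup Γ] [LinearOrder Γ]
  {ι : K →ₐ[F] A} {U : ConjugatingUnits ι} {ε : Γ →+ Additive Gal(K/F)}

variable (U ε) in
theorem span_range_leadingCoeff [IsGalois F K] (hε : Function.Surjective ε) :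
    Submodule.span F (Set.range fun x : MalcevNeumann U ε => x.toHahn.leadingCoeff) = ⊤ := by
  rw [eq_top_iff]
  intro a _
  obtain ⟨f, rfl, hf⟩ := exists_sum_galois_eigenvectors ι a
  refine Submodule.sum_mem _ fun σ _ => Submodule.subset_span ?_
  obtain ⟨γ, hγ⟩ := hε (Additive.ofMul σ)
  obtain ⟨x, hx⟩ := exists_toHahn_eq_single U ε γ (a := f σ) (by rw [hγ]; exact hf σ)
  exact ⟨x, by dsimp only; rw [hx]; exact HahnSeries.leadingCoeff_of_single⟩

variable [IsOrderedAddMonoid Γ] [IsMulCommutative Gal(K/F)]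

/-- Commuting with monomials, whose coefficients are arbitrary eigenvectors, puts each coefficient
of a central series in the center F of A. A nonzero scalar in the eigenspace of ε(γ) forces ε(γ) =
1. -/
theorem isCentral [IsGalois F K] [Algebra.IsCentral F A] (hε : Function.Surjective ε) :
    Algebra.IsCentral (HahnSeries ε.ker F) (MalcevNeumann U ε) := by
  refine ⟨fun x hx => ?_⟩
  rw [Subalgebra.mem_center_iff] at hx
  have hcoeff : ∀ γ, ∃ c : F, algebraMap F A c = x.toHahn.coeff γ := by
    intro γ
    have h : x.toHahn.coeff γ ∈ Subalgebra.center F A := by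
      rw [Subalgebra.mem_center_iff]
      intro a
      obtain ⟨f, rfl, hf⟩ := exists_sum_galois_eigenvectors ι a
      rw [Finset.sum_mul, Finset.mul_sum]
      refine Finset.sum_congr rfl fun σ _ => ?_
      obtain ⟨δ, hδ⟩ := hε (Additive.ofMul σ)
      obtain ⟨y, hy⟩ := exists_toHahn_eq_single U ε δ (a := f σ) (by rw [hδ]; exact hf σ)
      have h1 := congrArg (fun z => z.toHahn.coeff (γ + δ)) (hx y)
      simpa only [toHahn_mul, hy, HahnSeries.coeff_single_mul_add,
        HahnSeries.coeff_mul_single_add] using h1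
    rw [Algebra.IsCentral.center_eq_bot] at h
    exact Algebra.mem_bot.1 h
  choose c hc using hcoeff
  have hker : ∀ γ, γ ∉ ε.ker → x.toHahn.coeff γ = 0 := by
    intro γ hγ
    by_contra hne
    refine hγ ?_
    rw [AddMonoidHom.mem_ker]
    have h1 : (ε γ).toMul = 1 := by
      ext y
      have h2 := comm_coeff_toHahn x γ y
      rw [← hc, ← Algebra.commutes, hc] at h2
      exact (ι.toRingHom.injective (mul_left_cancel₀ hne h2)).symm
    exact h1
  obtain ⟨f, hf⟩ := HahnSeries.exists_coeff_eq_of_notMem (g := fun δ : ε.ker => c δ)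
    (f := fun δ : ε.ker => (δ : Γ)) (fun _ _ h => h) x.toHahn.isPWO_support fun δ h => by
      rw [HahnSeries.mem_support, not_not, ← hc] at h
      exact (map_eq_zero _).1 h
  refine Algebra.mem_bot.2 ⟨f, toHahn_injective ?_⟩
  rw [algebraMap_eq_ofKer]
  ext γ
  by_cases hγ : γ ∈ ε.ker
  · rw [coeff_toHahn_ofKer f ⟨γ, hγ⟩, hf, hc]
  · rw [coeff_toHahn_ofKer_of_notMem f hγ, hker γ hγ]

variable [FiniteDimensional F A]

theorem exists_span_eq_top (hε : Function.Surjective ε) :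
    ∃ m : Gal(K/F) × Fin (Module.finrank F (fieldCentralizer ι)) → MalcevNeumann U ε,
      Submodule.span (HahnSeries ε.ker F) (Set.range m) = ⊤ := by
  classical
  choose γ hγ using fun σ : Gal(K/F) => hε (Additive.ofMul σ)
  have hγ' : ∀ σ, (ε (γ σ)).toMul = σ := fun σ => by rw [hγ]; rfl
  let b := Module.finBasis F (fieldCentralizer ι)
  have hm : ∀ p : Gal(K/F) × Fin (Module.finrank F (fieldCentralizer ι)),
      ∃ x : MalcevNeumann U ε, x.toHahn = HahnSeries.single (γ p.1) (U.u p.1 * (b p.2 : A)) :=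
    fun p => exists_toHahn_eq_single U ε _ fun y => by rw [hγ']; exact U.comm_mul_coe _ _ _
  choose m hm using hm
  refine ⟨m, ?_⟩
  rw [eq_top_iff]
  intro x _
  -- Exponents are sorted by cosets of ker ε, with γ σ representing the coset over σ. The scalar at
  -- p collects one coordinate of the coefficients of x along that coset.
  have hf : ∀ p : Gal(K/F) × Fin (Module.finrank F (fieldCentralizer ι)),
      ∃ f : HahnSeries ε.ker F, ∀ δ : ε.ker,
        f.coeff δ = b.repr (x.series.coeff (γ p.1 + δ)) p.2 := fun p => by
    refine HahnSeries.exists_coeff_eq_of_notMem (f := fun δ : ε.ker => γ p.1 + δ)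
      (fun δ δ' h => le_of_add_le_add_left (a := γ p.1) h) x.series.isPWO_support fun δ h => ?_
    rw [HahnSeries.mem_support, not_not] at h
    rw [h, map_zero, Finsupp.zero_apply]
  choose f hf using hf
  have hx : x = ∑ p, f p • m p := by
    apply toHahn_injective
    rw [toHahn_sum]
    ext g
    have hcoeff : ∀ p, (f p • m p).toHahn.coeff g = if p.1 = (ε g).toMul then
        (U.u (ε g).toMul : A) * (b.repr (x.series.coeff g) p.2 • (b p.2 : A)) else 0 := by
      intro p
      rw [toHahn_smul, hm, HahnSeries.coeff_mul_single]
      split_ifs with h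
      · have hk : g - γ p.1 ∈ ε.ker := by
          rw [AddMonoidHom.mem_ker, map_sub, hγ, h]
          exact sub_self _
        have := coeff_toHahn_ofKer (U := U) (f p) ⟨_, hk⟩
        dsimp only at this
        rw [this, hf]
        dsimp only
        rw [add_sub_cancel, ← h, Algebra.commutes, Algebra.smul_def, Algebra.commutes, mul_assoc]
      · rw [coeff_toHahn_ofKer_of_notMem, zero_mul]
        intro hk
        rw [AddMonoidHom.mem_ker, map_sub, hγ, sub_eq_zero] at hk
        exact h (by rw [hk]; rfl)
    rw [HahnSeries.coeff_sum, Finset.sum_congr rfl fun p _ => hcoeff p, Fintype.sum_prod_type_right]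
    simp only [Finset.sum_ite_eq', Finset.mem_univ, if_true]
    rw [← Finset.mul_sum, coeff_toHahn]
    congr 1
    conv_lhs => rw [← b.sum_repr (x.series.coeff g)]
    rw [AddSubmonoidClass.coe_finsetSum]
    rfl
  rw [hx]
  exact Submodule.sum_mem _ fun p _ => Submodule.smul_mem _ _ (Submodule.subset_span ⟨p, rfl⟩)

theorem finiteDimensional (hε : Function.Surjective ε) :
    FiniteDimensional (HahnSeries ε.ker F) (MalcevNeumann U ε) := by
  obtain ⟨m, hm⟩ := exists_span_eq_top (U := U) hε
  exact ⟨Submodule.fg_def.2 ⟨_, Set.finite_range m, hm⟩⟩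

variable [IsGalois F K]

theorem finrank_le (hε : Function.Surjective ε) :
    Module.finrank (HahnSeries ε.ker F) (MalcevNeumann U ε) ≤ Module.finrank F A := by
  obtain ⟨m, hm⟩ := exists_span_eq_top (U := U) hε
  have h := finrank_range_le_card (R := HahnSeries ε.ker F) m
  rw [Set.finrank, hm, finrank_top, Fintype.card_prod, Fintype.card_fin] at h
  exact h.trans U.card_mul_finrank_le

/-- The dimension of a subspace is at most that of the span of its leading coefficients. -/
theorem finrank_submodule_le (hε : Function.Surjective ε)
    (W : Submodule (HahnSeries ε.ker F) (MalcevNeumann U ε)) :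
    Module.finrank (HahnSeries ε.ker F) W ≤ Module.finrank F
      (Submodule.span F ((fun x : MalcevNeumann U ε => x.toHahn.leadingCoeff) '' W)) := by
  have := finiteDimensional (U := U) hε
  set P := Submodule.span F ((fun x : MalcevNeumann U ε => x.toHahn.leadingCoeff) '' W) with hP
  -- A basis of A / P is lifted to elements m of the ring. Nonzero combinations of m have leading
  -- coefficients outside P, so their span, of dimension dim A - dim P, meets W trivially; the bound
  -- on the total dimension concludes.
  obtain ⟨t, ht, htspan, hti⟩ := exists_linearIndependent F
    (P.mkQ '' Set.range fun x : MalcevNeumann U ε => x.toHahn.leadingCoeff)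
  rw [Submodule.span_image, span_range_leadingCoeff U ε hε, Submodule.map_top,
    Submodule.range_mkQ] at htspan
  have hlift : ∀ a : t, ∃ x : MalcevNeumann U ε, P.mkQ x.toHahn.leadingCoeff = a := by
    intro a
    obtain ⟨_, ⟨x, rfl⟩, hx⟩ := ht a.2
    exact ⟨x, hx⟩
  choose m hm using hlift
  have hmi : LinearIndependent F (P.mkQ ∘ fun a => (m a).toHahn.leadingCoeff) := by
    rwa [show (P.mkQ ∘ fun a => (m a).toHahn.leadingCoeff) = ((↑) : t → A ⧸ P) from funext hm]
  have hmi' : LinearIndependent F fun a => (m a).toHahn.leadingCoeff := hmi.of_comp _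
  have hdisj := Submodule.range_ker_disjoint hmi
  rw [Submodule.ker_mkQ] at hdisj
  have : Finite t := hmi'.finite
  have : Fintype t := Fintype.ofFinite t
  have hcard : Fintype.card t + Module.finrank F P = Module.finrank F A := by
    rw [← P.finrank_quotient_add_finrank, ← finrank_top F (A ⧸ P), ← htspan,
      finrank_span_set_eq_card (R := F) (s := t) hti, Set.toFinset_card]
  have hV := finrank_span_eq_card (linearIndependent_of_leadingCoeff hmi')
  have hWV : Disjoint W (Submodule.span (HahnSeries ε.ker F) (Set.range m)) := by
    rw [Submodule.disjoint_def]
    intro x hxW hxV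
    obtain ⟨f, rfl⟩ := (Submodule.mem_span_range_iff_exists_fun _).1 hxV
    by_contra hne
    have hf : ∃ i ∈ Finset.univ, f i ≠ 0 := by
      by_contra! h
      exact hne (Finset.sum_eq_zero fun i hi => by rw [h i hi, zero_smul])
    have h1 := (leadingCoeff_toHahn_sum_mem_span hmi' Finset.univ f hf).2
    rw [Finset.coe_univ, Set.image_univ] at h1
    have h2 := Submodule.disjoint_def.1 hdisj _ h1 (Submodule.subset_span ⟨_, hxW, rfl⟩)
    rw [HahnSeries.leadingCoeff_eq_zero, toHahn_eq_zero] at h2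
    exact hne h2
  have h := Submodule.finrank_add_finrank_le_of_disjoint hWV
  have := finrank_le (U := U) hε
  omega

theorem finrank_eq (hε : Function.Surjective ε) :
    Module.finrank (HahnSeries ε.ker F) (MalcevNeumann U ε) = Module.finrank F A := by
  have := finiteDimensional (U := U) hε
  refine le_antisymm (finrank_le hε) ?_
  obtain ⟨t, ht, htspan, hti⟩ := exists_linearIndependent F
    (Set.range fun x : MalcevNeumann U ε => x.toHahn.leadingCoeff)
  rw [span_range_leadingCoeff U ε hε] at htspan
  choose m hm using fun a : t => ht a.2
  have hmi : LinearIndependent F fun a => (m a).toHahn.leadingCoeff := by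
    rwa [show (fun a => (m a).toHahn.leadingCoeff) = ((↑) : t → A) from funext hm]
  have : Finite t := hmi.finite
  have : Fintype t := Fintype.ofFinite t
  have h := (linearIndependent_of_leadingCoeff hmi).fintype_card_le_finrank
  rwa [← Set.toFinset_card, ← finrank_span_set_eq_card (R := F) (s := t) hti, htspan,
    finrank_top] at h

end MalcevNeumann

/-! ### Maximality and separability of subfields -/

section AbstractSubfields

universe u

theorem Subalgebra.isField_of_commute {F A : Type*} [Field F] [DivisionRing A] [Algebra F A]
    [FiniteDimensional F A] {S : Subalgebra F A} (h : ∀ x ∈ S, ∀ y ∈ S, x * y = y * x) :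
    IsField S where
  exists_pair_ne := ⟨0, 1, zero_ne_one⟩
  mul_comm x y := Subtype.ext (h x x.2 y y.2)
  mul_inv_cancel {x} hx := by
    have := FiniteDimensional.isUnit F hx
    exact this.exists_right_inv

/-- Passing to an abstract field keeps a second ring structure off the subalgebra. -/
theorem IsField.exists_field_algEquiv {F : Type*} {S : Type u} [Field F] [Ring S] [Algebra F S]
    (h : IsField S) : ∃ (E : Type u) (_ : Field E) (_ : Algebra F E), Nonempty (E ≃ₐ[F] S) :=
  ⟨S, h.toField, ‹Algebra F S›, ⟨AlgEquiv.refl⟩⟩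

theorem IsGaloisExtension.exists_field_algEquiv {F : Type*} {S : Type u} [Field F] [Ring S]
    [Algebra F S] (h : IsGaloisExtension F S) :
    ∃ (E : Type u) (_ : Field E) (_ : Algebra F E), IsGalois F E ∧ Nonempty (E ≃ₐ[F] S) :=
  ⟨S, h.choose.toField, ‹Algebra F S›, h.choose_spec, ⟨AlgEquiv.refl⟩⟩

theorem IsGaloisExtension.of_algEquiv {F E S : Type*} [Field F] [Field E] [Algebra F E] [Ring S]
    [Algebra F S] [IsGalois F E] (e : E ≃ₐ[F] S) : IsGaloisExtension F S := by
  have h : IsField S := e.symm.toMulEquiv.isField (Field.toIsField E)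
  exact ⟨h, @IsGalois.of_algEquiv F E _ _ S h.toField ‹Algebra F S› ‹Algebra F E› _ e⟩

theorem AlgHom.isField_range {F E A : Type*} [Field F] [Field E] [Algebra F E] [Ring A]
    [Nontrivial A] [Algebra F A] (f : E →ₐ[F] A) : IsField f.range :=
  (AlgEquiv.ofInjective f f.toRingHom.injective).symm.toMulEquiv.isField (Field.toIsField E)

theorem Subalgebra.range_val_comp_algEquiv {F E A : Type*} [Field F] [Field E] [Algebra F E]
    [Ring A] [Algebra F A] {S : Subalgebra F A} (e : E ≃ₐ[F] S) :
    (S.val.comp e.toAlgHom).range = S := by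
  ext a
  exact ⟨fun ⟨r, hr⟩ => hr ▸ (e r).2,
    fun ha => ⟨e.symm ⟨a, ha⟩, congrArg Subtype.val (e.apply_symm_apply _)⟩⟩

theorem IsMaximalSubfield.of_finrank_sq {F A E : Type*} [Field F] [DivisionRing A] [Algebra F A]
    [Algebra.IsCentral F A] [FiniteDimensional F A] [Field E] [Algebra F E] (f : E →ₐ[F] A)
    (h : Module.finrank F A ≤ Module.finrank F E ^ 2) : IsMaximalSubfield f.range := by
  refine ⟨f.isField_range, fun S hS hle => ?_⟩
  obtain ⟨E', _, _, ⟨e⟩⟩ := hS.exists_field_algEquiv (F := F)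
  have h1 := finrank_sq_le_of_algHom (S.val.comp e.toAlgHom)
  have h2 : Module.finrank F E' ≤ Module.finrank F E :=
    (Nat.pow_le_pow_iff_left two_ne_zero).1 (h1.trans h)
  rw [e.toLinearEquiv.finrank_eq,
    (AlgEquiv.ofInjective f f.toRingHom.injective).toLinearEquiv.finrank_eq] at h2
  exact (Subalgebra.eq_of_le_of_finrank_le hle h2).ge

theorem IsMaximalCommutative.mem_of_forall_comm {F A : Type*} [Field F] [Ring A] [Algebra F A]
    {L : Subalgebra F A} (hL : IsMaximalCommutative L) {a : A} (ha : ∀ x ∈ L, x * a = a * x) :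
    a ∈ L := by
  have hcomm : ∀ x ∈ insert a (L : Set A), ∀ y ∈ insert a (L : Set A), x * y = y * x := by
    rintro x (rfl | hx) y (rfl | hy)
    · rfl
    · exact (ha y hy).symm
    · exact ha x hx
    · exact hL.1 x hx y hy
  have hadj := Algebra.isMulCommutative_adjoin F hcomm
  refine hL.2 (y := Algebra.adjoin F (insert a (L : Set A))) (fun x hx y hy => ?_)
    (fun x hx => Algebra.subset_adjoin (Set.mem_insert_of_mem _ hx))
    (Algebra.subset_adjoin (Set.mem_insert _ _))
  exact congrArg Subtype.val
    (hadj.is_comm.comm (⟨x, hx⟩ : Algebra.adjoin F (insert a (L : Set A))) ⟨y, hy⟩)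

/-- The degree n of a minimal polynomial divides [E:F], so n ≠ 0 in F; and n is the coefficient of
its derivative in degree n - 1. -/
theorem Algebra.isSeparable_of_not_ringChar_dvd_finrank {F E : Type*} [Field F] [Field E]
    [Algebra F E] [FiniteDimensional F E] (h : ¬ ringChar F ∣ Module.finrank F E) :
    Algebra.IsSeparable F E := by
  refine ⟨fun x => ?_⟩
  have hx := Algebra.IsIntegral.isIntegral (R := F) x
  rw [IsSeparable, Polynomial.separable_iff_derivative_ne_zero (minpoly.irreducible hx)]
  intro h0
  refine h (dvd_trans ?_ (minpoly.degree_dvd hx))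
  rw [← ringChar.spec]
  have hpos := minpoly.natDegree_pos hx
  have h1 := congrArg (fun p => p.coeff ((minpoly F x).natDegree - 1)) h0
  simp only [Polynomial.coeff_derivative, Nat.sub_add_cancel hpos, Polynomial.coeff_zero] at h1
  rw [← Nat.cast_add_one, Nat.sub_add_cancel hpos] at h1
  rwa [Polynomial.coeff_natDegree, (minpoly.monic hx).leadingCoeff, one_mul] at h1

end AbstractSubfields

/-! ### The residue field of a Galois subfield -/

section HahnSeriesResidue

variable {A Γ : Type*} [DivisionRing A] [AddCommGroup Γ] [LinearOrder Γ] [IsOrderedAddMonoid Γ]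

theorem HahnSeries.coeff_zero_mul {x y : HahnSeries Γ A} (hx : 0 ≤ x.orderTop)
    (hy : 0 ≤ y.orderTop) : (x * y).coeff 0 = x.coeff 0 * y.coeff 0 := by
  rcases hx.eq_or_lt with hx | hx
  · rcases hy.eq_or_lt with hy | hy
    · have hx0 : x ≠ 0 := by rintro rfl; simp at hx
      have hy0 : y ≠ 0 := by rintro rfl; simp at hy
      rw [← HahnSeries.order_eq_orderTop_of_ne_zero hx0] at hx
      rw [← HahnSeries.order_eq_orderTop_of_ne_zero hy0] at hy
      have hx' : x.order = 0 := (WithTop.coe_injective hx).symm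
      have hy' : y.order = 0 := (WithTop.coe_injective hy).symm
      have := HahnSeries.coeff_mul_order_add_order x y
      rwa [HahnSeries.leadingCoeff_eq, HahnSeries.leadingCoeff_eq, hx', hy', add_zero] at this
    · have h1 : 0 < (x * y).orderTop := by rw [HahnSeries.orderTop_mul, ← hx, zero_add]; exact hy
      rw [HahnSeries.coeff_eq_zero_of_lt_orderTop h1, HahnSeries.coeff_eq_zero_of_lt_orderTop hy,
        mul_zero]
  · have h1 : 0 < (x * y).orderTop := by
      rw [HahnSeries.orderTop_mul]
      exact add_pos_of_pos_of_nonneg hx hy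
    rw [HahnSeries.coeff_eq_zero_of_lt_orderTop h1, HahnSeries.coeff_eq_zero_of_lt_orderTop hx,
      zero_mul]

theorem HahnSeries.orderTop_eq_of_mul_eq_mul {x y u : HahnSeries Γ A} (hu : u ≠ 0)
    (h : u * y = x * u) : y.orderTop = x.orderTop := by
  have h1 := congrArg HahnSeries.orderTop h
  rw [HahnSeries.orderTop_mul, HahnSeries.orderTop_mul, add_comm x.orderTop] at h1
  exact WithTop.add_left_cancel (HahnSeries.orderTop_ne_top.2 hu) h1

end HahnSeriesResidue

namespace MalcevNeumann

variable {F A K Γ L : Type*} [Field F] [DivisionRing A] [Algebra F A]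
  [Field K] [Algebra F K]
  [AddCommGroup Γ] [LinearOrder Γ] [IsOrderedAddMonoid Γ] [IsMulCommutative Gal(K/F)]
  {ι : K →ₐ[F] A} {U : ConjugatingUnits ι} {ε : Γ →+ Additive Gal(K/F)}
  [Field L] [Algebra (HahnSeries ε.ker F) L]

/-- The elements of nonnegative order in a subfield of the Mal'cev-Neumann ring. -/
def integers (j : L →ₐ[HahnSeries ε.ker F] MalcevNeumann U ε) : Subring L where
  carrier := {l | 0 ≤ (j l).toHahn.orderTop}
  mul_mem' {a b} ha hb := by
    change 0 ≤ (j (a * b)).toHahn.orderTop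
    rw [map_mul, toHahn_mul, HahnSeries.orderTop_mul]
    exact add_nonneg ha hb
  one_mem' := by
    change 0 ≤ (j 1).toHahn.orderTop
    rw [map_one, toHahn_one, HahnSeries.orderTop_one]
  add_mem' {a b} ha hb := by
    change 0 ≤ (j (a + b)).toHahn.orderTop
    rw [map_add, toHahn_add]
    exact (le_min ha hb).trans HahnSeries.min_orderTop_le_orderTop_add
  zero_mem' := by
    change 0 ≤ (j 0).toHahn.orderTop
    rw [map_zero, toHahn_zero, HahnSeries.orderTop_zero]
    exact le_top
  neg_mem' {a} ha := by
    change 0 ≤ (j (-a)).toHahn.orderTop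
    rw [map_neg, toHahn_neg, HahnSeries.orderTop_neg]
    exact ha

variable (j : L →ₐ[HahnSeries ε.ker F] MalcevNeumann U ε)

theorem mem_integers {l : L} : l ∈ integers j ↔ 0 ≤ (j l).toHahn.orderTop := Iff.rfl

/-- The constant coefficient. -/
noncomputable def residueMap : integers j →+* A where
  toFun l := (j l).toHahn.coeff 0
  map_one' := by simp [toHahn_one]
  map_mul' a b := by
    rw [Subring.coe_mul, map_mul, toHahn_mul, HahnSeries.coeff_zero_mul a.2 b.2]
  map_zero' := by simp [toHahn_zero]
  map_add' a b := by simp [toHahn_add]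

theorem residueMap_apply (l : integers j) : residueMap j l = (j l).toHahn.coeff 0 := rfl

theorem algebraMap_single_mem_integers (c : F) :
    algebraMap (HahnSeries ε.ker F) L (HahnSeries.single 0 c) ∈ integers j := by
  rw [mem_integers, j.commutes, algebraMap_eq_ofKer, toHahn_ofKer_single]
  exact HahnSeries.orderTop_single_le

theorem residueMap_algebraMap_single (c : F) :
    residueMap j ⟨_, algebraMap_single_mem_integers j c⟩ = algebraMap F A c := by
  rw [residueMap_apply, j.commutes, algebraMap_eq_ofKer, toHahn_ofKer_single]
  exact HahnSeries.coeff_single_same _ _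

/-- The residue field of a subfield of the Mal'cev-Neumann ring. -/
noncomputable def residueField : Subalgebra F A :=
  { (residueMap j).range with
    algebraMap_mem' := fun c => ⟨_, residueMap_algebraMap_single j c⟩ }

theorem mem_residueField {a : A} : a ∈ residueField j ↔ ∃ l, residueMap j l = a := Iff.rfl

theorem residueField_commute : ∀ x ∈ residueField j, ∀ y ∈ residueField j, x * y = y * x := by
  rintro _ ⟨l, rfl⟩ _ ⟨l', rfl⟩
  change residueMap j l * residueMap j l' = residueMap j l' * residueMap j l
  rw [← map_mul, mul_comm, map_mul]

theorem comm_of_mem_residueField {a : A} (ha : a ∈ residueField j) (x : K) : ι x * a = a * ι x := by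
  obtain ⟨l, rfl⟩ := ha
  have h := comm_coeff_toHahn (j l) 0 x
  rwa [map_zero] at h

variable [FiniteDimensional F A] [FiniteDimensional F K]
  [IsGalois F K]
  [FiniteDimensional (HahnSeries ε.ker F) L] [IsGalois (HahnSeries ε.ker F) L]

/-- By Skolem-Noether τ is induced by conjugation in the whole division ring, and conjugation
preserves the order because Γ is commutative. -/
theorem galois_mem_integers [Algebra.IsCentral F A] (hε : Function.Surjective ε)
    (τ : Gal(L/HahnSeries ε.ker F)) {l : L}
    (hl : l ∈ integers j) : τ l ∈ integers j := by
  have := finiteDimensional (U := U) hε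
  have hc := isCentral (U := U) hε
  let _ : DivisionRing (MalcevNeumann U ε) :=
    divisionRingOfFiniteDimensional (HahnSeries ε.ker F) (MalcevNeumann U ε)
  obtain ⟨u, hu⟩ := exists_unit_conj_eq (F := HahnSeries ε.ker F) j τ
  have h1 : (u : MalcevNeumann U ε) * j (τ l) = j l * u := by
    rw [hu, ← mul_assoc, ← mul_assoc, Units.mul_inv, one_mul]
  rw [mem_integers, HahnSeries.orderTop_eq_of_mul_eq_mul (x := (j l).toHahn)
    (u := (u : MalcevNeumann U ε).toHahn)]
  · exact hl
  · rw [Ne, toHahn_eq_zero]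
    exact u.ne_zero
  · rw [← toHahn_mul, ← toHahn_mul, h1]

theorem finrank_le_sq_of_isMaximalCommutative (hε : Function.Surjective ε)
    (hj : IsMaximalCommutative j.range) :
    Module.finrank F A ≤ Module.finrank (HahnSeries ε.ker F) L ^ 2 := by
  have := finiteDimensional (U := U) hε
  rw [← finrank_eq (U := U) hε]
  let _ : DivisionRing (MalcevNeumann U ε) :=
    divisionRingOfFiniteDimensional (HahnSeries ε.ker F) (MalcevNeumann U ε)
  refine finrank_le_sq_of_self_centralizing (F := HahnSeries ε.ker F) j fun a ha => ?_
  refine hj.mem_of_forall_comm ?_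
  rintro _ ⟨x, rfl⟩
  exact ha x

-- Lift r to an integer l. The product of the X - τ l reduces to a product of linear factors over
-- the residue field that has r as a root. Its coefficients come from F((ker ε)), so their residues
-- lie in F.
open Polynomial in
theorem normal_residueField [Algebra.IsCentral F A] (hε : Function.Surjective ε)
    {R : Type*} [Field R] [Algebra F R]
    (e : R ≃ₐ[F] residueField j) : Normal F R := by
  have : FiniteDimensional F R := e.symm.toLinearEquiv.finiteDimensional
  let ρ : integers j →+* R :=
    (e.symm : residueField j →+* R).comp ((residueMap j).codRestrict (residueField j)
      fun l => ⟨l, rfl⟩)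
  have hρ : ∀ l, (e (ρ l) : A) = residueMap j l := fun l =>
    congrArg Subtype.val (e.apply_symm_apply _)
  refine normal_iff.2 fun r => ⟨Algebra.IsIntegral.isIntegral r, ?_⟩
  obtain ⟨l, hl⟩ := (mem_residueField j).1 (e r).2
  have hlr : ρ l = r := e.injective (Subtype.ext ((hρ l).trans hl))
  let Q : (integers j)[X] :=
    ∏ τ : Gal(L/HahnSeries ε.ker F), (X - C ⟨τ l, galois_mem_integers j hε τ l.2⟩)
  obtain ⟨P, hP⟩ := Algebra.IsInvariant.charpoly_mem_lifts (HahnSeries ε.ker F) L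
    Gal(L/HahnSeries ε.ker F) (l : L)
  have hQP : Q.map (integers j).subtype = P.map (algebraMap _ L) := by
    rw [← coe_mapRingHom (algebraMap _ L)]
    refine Eq.trans ?_ hP.symm
    simp only [Q, Polynomial.map_prod, Polynomial.map_sub, map_X, map_C]
    rfl
  have hQρ : Q.map ρ = ∏ τ : Gal(L/HahnSeries ε.ker F),
      (X - C (ρ ⟨τ l, galois_mem_integers j hε τ l.2⟩)) := by
    simp only [Q, Polynomial.map_prod, Polynomial.map_sub, map_X, map_C]
  have hlift : Q.map ρ ∈ lifts (algebraMap F R) := by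
    rw [lifts_iff_coeff_lifts]
    intro n
    rw [coeff_map]
    have h1 : ((Q.coeff n : integers j) : L) = algebraMap _ L (P.coeff n) := by
      have := congrArg (fun p => p.coeff n) hQP
      rw [coeff_map, coeff_map] at this
      exact this
    obtain ⟨c, hc⟩ := exists_coeff_toHahn_ofKer (U := U) (P.coeff n) 0
    refine ⟨c, e.injective (Subtype.ext ?_)⟩
    rw [hρ, e.commutes, residueMap_apply, h1, j.commutes, algebraMap_eq_ofKer, hc]
    rfl
  obtain ⟨q, hq⟩ := hlift
  rw [coe_mapRingHom] at hq
  have hsplit : (q.map (algebraMap F R)).Splits := by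
    rw [hq, hQρ]
    exact Splits.prod fun τ _ => Splits.X_sub_C _
  have hne : q.map (algebraMap F R) ≠ 0 := by
    rw [hq, hQρ]
    exact Finset.prod_ne_zero_iff.2 fun τ _ => X_sub_C_ne_zero _
  have hroot : aeval r q = 0 := by
    rw [← eval_map_algebraMap, hq, hQρ, eval_prod]
    refine Finset.prod_eq_zero (Finset.mem_univ 1) ?_
    simp [hlr]
  exact hsplit.of_dvd hne (Polynomial.map_dvd _ (minpoly.dvd F r hroot))

end MalcevNeumann

/-! ### The compositum of K and the residue field -/

section Conjugation

/-- Conjugation by a nonzero element of a division algebra. -/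
def AlgHom.conjBy (F : Type*) {A : Type*} [Field F] [DivisionRing A] [Algebra F A] (b : A)
    (hb : b ≠ 0) : A →ₐ[F] A where
  toFun a := b⁻¹ * a * b
  map_one' := by simp [hb]
  map_mul' x y := by
    simp only [mul_assoc]
    rw [mul_inv_cancel_left₀ hb]
  map_zero' := by simp
  map_add' x y := by simp [mul_add, add_mul]
  commutes' c := by rw [← Algebra.commutes, mul_assoc, inv_mul_cancel₀ hb, mul_one]

theorem AlgHom.conjBy_apply_of_comm {F A : Type*} [Field F] [DivisionRing A] [Algebra F A] {b : A}
    (hb : b ≠ 0) {x y : A} (h : x * b = b * y) : AlgHom.conjBy F b hb x = y := by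
  change b⁻¹ * x * b = y
  rw [mul_assoc, h, inv_mul_cancel_left₀ hb]

end Conjugation

theorem AlgHom.exists_comp_eq_of_range_le {F A E M : Type*} [Field F] [Ring A] [Nontrivial A]
    [Algebra F A] [Semiring E] [Algebra F E] [Field M] [Algebra F M] (μ : M →ₐ[F] A) (f : E →ₐ[F] A)
    (hle : f.range ≤ μ.range) : ∃ g : E →ₐ[F] M, ∀ x, μ (g x) = f x := by
  refine ⟨(AlgEquiv.ofInjective μ μ.toRingHom.injective).symm.toAlgHom.comp
    (f.codRestrict μ.range fun x => hle ⟨x, rfl⟩), fun x => ?_⟩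
  exact congrArg Subtype.val
    ((AlgEquiv.ofInjective μ μ.toRingHom.injective).apply_symm_apply _)

section Compositum

variable {F A K R M : Type*} [Field F] [DivisionRing A] [Algebra F A] [Field K] [Algebra F K]
  [Field R] [Algebra F R] [Field M] [Algebra F M] {ι : K →ₐ[F] A} {e : R →ₐ[F] A} {μ : M →ₐ[F] A}

theorem normal_of_range_eq_sup [Normal F K] [Normal F R] (hμ : μ.range = ι.range ⊔ e.range) :
    Normal F M := by
  obtain ⟨κ, hκ⟩ := μ.exists_comp_eq_of_range_le ι (hμ ▸ le_sup_left)
  obtain ⟨ν, hν⟩ := μ.exists_comp_eq_of_range_le e (hμ ▸ le_sup_right)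
  have : Normal F κ.fieldRange :=
    Normal.of_algEquiv (AlgEquiv.ofInjective κ κ.toRingHom.injective)
  have : Normal F ν.fieldRange :=
    Normal.of_algEquiv (AlgEquiv.ofInjective ν ν.toRingHom.injective)
  have htop : κ.fieldRange ⊔ ν.fieldRange = ⊤ := by
    rw [eq_top_iff]
    intro m _
    have h1 : μ m ∈ (κ.range ⊔ ν.range).map μ := by
      rw [Algebra.map_sup, ← AlgHom.range_comp, ← AlgHom.range_comp,
        show μ.comp κ = ι from AlgHom.ext hκ, show μ.comp ν = e from AlgHom.ext hν, ← hμ]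
      exact ⟨m, rfl⟩
    obtain ⟨m', hm', h2⟩ := h1
    obtain rfl : m' = m := μ.toRingHom.injective h2
    have hle : κ.range ⊔ ν.range ≤ (κ.fieldRange ⊔ ν.fieldRange).toSubalgebra :=
      sup_le (fun x hx => (le_sup_left : κ.fieldRange ≤ κ.fieldRange ⊔ ν.fieldRange) hx)
        (fun x hx => (le_sup_right : ν.fieldRange ≤ κ.fieldRange ⊔ ν.fieldRange) hx)
    exact hle hm'
  have h : Normal F (κ.fieldRange ⊔ ν.fieldRange : IntermediateField F M) := inferInstance
  rw [htop] at h
  exact Normal.of_algEquiv IntermediateField.topEquiv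

/-- Elements inducing different automorphisms of `K` and commuting with `R` give different
automorphisms of the compositum of `K` and `R` over `R`. -/
theorem card_mul_finrank_le_of_range_eq_sup [FiniteDimensional F A]
    (hμ : μ.range = ι.range ⊔ e.range) (S : Finset Gal(K/F)) (b : Gal(K/F) → A)
    (hb : ∀ σ ∈ S, b σ ≠ 0) (hbK : ∀ σ ∈ S, ∀ x, ι x * b σ = b σ * ι (σ x))
    (hbR : ∀ σ ∈ S, ∀ r, e r * b σ = b σ * e r) :
    S.card * Module.finrank F R ≤ Module.finrank F M := by
  have : FiniteDimensional F M :=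
    FiniteDimensional.of_injective μ.toLinearMap μ.toRingHom.injective
  obtain ⟨κ, hκ⟩ := μ.exists_comp_eq_of_range_le ι (hμ ▸ le_sup_left)
  obtain ⟨ν, hν⟩ := μ.exists_comp_eq_of_range_le e (hμ ▸ le_sup_right)
  let _ : Algebra R M := ν.toRingHom.toAlgebra
  have : IsScalarTower F R M := IsScalarTower.of_algebraMap_eq fun c => (ν.commutes c).symm
  have : FiniteDimensional R M := FiniteDimensional.right F R M
  have hs : ∀ σ : S, ∃ s : M →ₐ[R] M, ∀ x, s (κ x) = κ (σ.1 x) := by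
    rintro ⟨σ, hσ⟩
    let c := AlgHom.conjBy F (b σ) (hb σ hσ)
    have hcK : ∀ x, c (ι x) = ι (σ x) := fun x =>
      AlgHom.conjBy_apply_of_comm (hb σ hσ) (hbK σ hσ x)
    have hcR : ∀ r, c (e r) = e r := fun r =>
      AlgHom.conjBy_apply_of_comm (hb σ hσ) (hbR σ hσ r)
    -- Conjugation by b σ maps K to itself and fixes R pointwise, so it restricts to M.
    have hle : (c.comp μ).range ≤ μ.range := by
      rw [AlgHom.range_comp, hμ, Algebra.map_sup]
      refine sup_le_sup ?_ ?_
      · rintro _ ⟨_, ⟨x, rfl⟩, rfl⟩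
        exact ⟨σ x, (hcK x).symm⟩
      · rintro _ ⟨_, ⟨r, rfl⟩, rfl⟩
        exact ⟨r, (hcR r).symm⟩
    obtain ⟨s, hs⟩ := μ.exists_comp_eq_of_range_le (c.comp μ) hle
    refine ⟨{ s with
      commutes' := fun r => μ.toRingHom.injective ?_ }, fun x => μ.toRingHom.injective ?_⟩
    · change μ (s (ν r)) = μ (ν r)
      rw [hs, AlgHom.comp_apply, hν, hcR]
    · change μ (s (κ x)) = μ (κ (σ x))
      rw [hs, AlgHom.comp_apply, hκ, hκ, hcK]
  choose s hs using hs
  have hinj : Function.Injective s := by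
    intro σ τ h
    apply Subtype.ext
    ext x
    refine κ.toRingHom.injective ?_
    change κ (σ.1 x) = κ (τ.1 x)
    rw [← hs, ← hs, h]
  have h1 := Fintype.card_le_of_injective s hinj
  rw [Fintype.card_coe] at h1
  calc S.card * Module.finrank F R ≤ Module.finrank R M * Module.finrank F R :=
        Nat.mul_le_mul_right _ (h1.trans AlgHom.card_le)
    _ = Module.finrank F M := by rw [mul_comm, Module.finrank_mul_finrank]

end Compositum

/-! ### Comparison of degrees and conclusion -/

namespace MalcevNeumann

variable {F A K Γ L : Type*} [Field F] [DivisionRing A] [Algebra F A] [Field K] [Algebra F K]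
  [AddCommGroup Γ] [LinearOrder Γ] [IsOrderedAddMonoid Γ] [IsMulCommutative Gal(K/F)]
  {ι : K →ₐ[F] A} {U : ConjugatingUnits ι} {ε : Γ →+ Additive Gal(K/F)}
  [Field L] [Algebra (HahnSeries ε.ker F) L]

/-- A nonzero residue is the leading coefficient of an element of order 0, and leading coefficients
of commuting elements commute. -/
theorem leadingCoeff_commute_of_mem_residueField
    (j : L →ₐ[HahnSeries ε.ker F] MalcevNeumann U ε) {a : A} (ha : a ∈ residueField j) (l : L) :
    a * (j l).toHahn.leadingCoeff = (j l).toHahn.leadingCoeff * a := by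
  obtain ⟨l', rfl⟩ := ha
  change residueMap j l' * _ = _ * residueMap j l'
  rw [residueMap_apply]
  rcases (show 0 ≤ (j l').toHahn.orderTop from l'.2).eq_or_lt with h | h
  · have h0 : (j l').toHahn ≠ 0 := by
      intro h0
      simp [h0] at h
    rw [← HahnSeries.order_eq_orderTop_of_ne_zero h0] at h
    have h' : (j l').toHahn.order = 0 := (WithTop.coe_injective h).symm
    rw [← h', ← HahnSeries.leadingCoeff_eq, ← HahnSeries.leadingCoeff_mul,
      ← HahnSeries.leadingCoeff_mul, ← toHahn_mul, ← toHahn_mul, ← map_mul, mul_comm, map_mul]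
  · rw [HahnSeries.coeff_eq_zero_of_lt_orderTop h, zero_mul, mul_zero]

/-- Leading coefficients of elements whose orders have the same image under `ε` differ by an
element of the residue field. -/
theorem exists_leadingCoeff_eq_mul (j : L →ₐ[HahnSeries ε.ker F] MalcevNeumann U ε) {l l' : L}
    (hl : l ≠ 0) (hl' : l' ≠ 0) (h : ε (j l).toHahn.order = ε (j l').toHahn.order) :
    ∃ a ∈ residueField j, (j l').toHahn.leadingCoeff = (j l).toHahn.leadingCoeff * a := by
  have hker : (j l).toHahn.order - (j l').toHahn.order ∈ ε.ker := by
    rw [AddMonoidHom.mem_ker, map_sub, h, sub_self]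
  -- The monomial z moves l' to the order of l without changing its leading coefficient, so y has
  -- order 0 and its residue is the factor sought.
  let z : HahnSeries ε.ker F := HahnSeries.single ⟨_, hker⟩ 1
  let y : L := l⁻¹ * (z • l')
  have hne : ∀ {x : L}, x ≠ 0 → (j x).toHahn ≠ 0 := fun hx h0 =>
    hx (j.toRingHom.injective ((toHahn_eq_zero.1 h0).trans (map_zero j).symm))
  have hly : (j l).toHahn * (j y).toHahn =
      HahnSeries.single ((j l).toHahn.order - (j l').toHahn.order) 1 * (j l').toHahn := by
    rw [← toHahn_mul, ← map_mul, mul_inv_cancel_left₀ hl, map_smul, toHahn_single_smul, map_one]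
  have hlc := congrArg HahnSeries.leadingCoeff hly
  rw [HahnSeries.leadingCoeff_mul, HahnSeries.leadingCoeff_mul, HahnSeries.leadingCoeff_of_single,
    one_mul] at hlc
  have hy : (j y).toHahn ≠ 0 := by
    intro h0
    rw [h0, HahnSeries.leadingCoeff_zero, mul_zero] at hlc
    exact hne hl' (HahnSeries.leadingCoeff_eq_zero.1 hlc.symm)
  have hord := congrArg HahnSeries.order hly
  rw [HahnSeries.order_mul (hne hl) hy, HahnSeries.order_mul (HahnSeries.single_ne_zero one_ne_zero)
    (hne hl'), HahnSeries.order_single one_ne_zero, sub_add_cancel, add_eq_left] at hord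
  have hyint : y ∈ integers j := by
    rw [mem_integers, ← HahnSeries.order_eq_orderTop_of_ne_zero hy, hord]
    rfl
  refine ⟨_, ⟨⟨y, hyint⟩, rfl⟩, ?_⟩
  change _ = _ * residueMap j ⟨y, hyint⟩
  rw [← hlc, residueMap_apply, HahnSeries.leadingCoeff_eq (x := (j y).toHahn), hord]

variable [FiniteDimensional F A] [FiniteDimensional F K] [IsGalois F K]

/-- The degree of a subfield of the Mal'cev-Neumann ring is at most the degree of the compositum of
`K` and the residue field. -/
theorem finrank_le_of_range_eq_sup (hε : Function.Surjective ε)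
    (j : L →ₐ[HahnSeries ε.ker F] MalcevNeumann U ε) {R M : Type*} [Field R] [Algebra F R] [Field M]
    [Algebra F M] (e : R ≃ₐ[F] residueField j) {μ : M →ₐ[F] A}
    (hμ : μ.range = ι.range ⊔ residueField j) :
    Module.finrank (HahnSeries ε.ker F) L ≤ Module.finrank F M := by
  classical
  have hb : ∀ σ : Gal(K/F), ∃ l : L, (∃ l' : L, l' ≠ 0 ∧ ε (j l').toHahn.order = .ofMul σ) →
      l ≠ 0 ∧ ε (j l).toHahn.order = .ofMul σ := fun σ => by
    by_cases h : ∃ l' : L, l' ≠ 0 ∧ ε (j l').toHahn.order = .ofMul σ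
    · exact ⟨h.choose, fun _ => h.choose_spec⟩
    · exact ⟨0, fun h' => absurd h' h⟩
  choose l hl using hb
  let S : Finset Gal(K/F) := Finset.univ.filter fun σ =>
    ∃ l' : L, l' ≠ 0 ∧ ε (j l').toHahn.order = .ofMul σ
  have hS : ∀ σ ∈ S, l σ ≠ 0 ∧ ε (j (l σ)).toHahn.order = .ofMul σ := fun σ hσ =>
    hl σ (Finset.mem_filter.1 hσ).2
  have he : ((residueField j).val.comp e.toAlgHom).range = residueField j :=
    Subalgebra.range_val_comp_algEquiv e
  have hne : ∀ {x : L}, x ≠ 0 → (j x).toHahn ≠ 0 := fun hx h0 =>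
    hx (j.toRingHom.injective ((toHahn_eq_zero.1 h0).trans (map_zero j).symm))
  refine le_trans ?_ (card_mul_finrank_le_of_range_eq_sup
    (e := (residueField j).val.comp e.toAlgHom) (he.symm ▸ hμ) S
    (fun σ => (j (l σ)).toHahn.leadingCoeff)
    (fun σ hσ => HahnSeries.leadingCoeff_ne_zero.2 (hne (hS σ hσ).1)) (fun σ hσ x => ?_)
    (fun σ hσ r => leadingCoeff_commute_of_mem_residueField j (e r).2 _))
  -- One element l σ of L is fixed for each σ in S. Every leading coefficient of L is that of some l
  -- σ times a residue, so the range of ψ contains them all.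
  · let ψ : (S → residueField j) →ₗ[F] A :=
      { toFun := fun a => ∑ σ : S, (j (l σ)).toHahn.leadingCoeff * (a σ : A)
        map_add' := fun a a' => by simp [mul_add, Finset.sum_add_distrib]
        map_smul' := fun c a => by simp [Finset.smul_sum] }
    have hψ : Submodule.span F ((fun x : MalcevNeumann U ε => x.toHahn.leadingCoeff) ''
        (j.toLinearMap.range : Set (MalcevNeumann U ε))) ≤ ψ.range := by
      rw [Submodule.span_le]
      rintro _ ⟨_, ⟨x, rfl⟩, rfl⟩
      change (j x).toHahn.leadingCoeff ∈ ψ.range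
      rcases eq_or_ne x 0 with rfl | hx
      · rw [map_zero, toHahn_zero, HahnSeries.leadingCoeff_zero]
        exact zero_mem _
      · have hσ : (ε (j x).toHahn.order).toMul ∈ S :=
          Finset.mem_filter.2 ⟨Finset.mem_univ _, x, hx, rfl⟩
        obtain ⟨h1, h2⟩ := hS _ hσ
        obtain ⟨a, ha, hxa⟩ := exists_leadingCoeff_eq_mul j h1 hx h2
        refine ⟨Pi.single ⟨_, hσ⟩ ⟨a, ha⟩, ?_⟩
        rw [hxa]
        change ∑ σ : S, _ = _
        rw [Finset.sum_eq_single ⟨_, hσ⟩]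
        · rw [Pi.single_eq_same]
        · intro τ _ hτ
          rw [Pi.single_eq_of_ne hτ, ZeroMemClass.coe_zero, mul_zero]
        · exact fun h => absurd (Finset.mem_univ _) h
    calc Module.finrank (HahnSeries ε.ker F) L
        = Module.finrank (HahnSeries ε.ker F) j.toLinearMap.range :=
          (LinearEquiv.ofInjective j.toLinearMap j.toRingHom.injective).finrank_eq
      _ ≤ _ := finrank_submodule_le hε _
      _ ≤ Module.finrank F ψ.range := Submodule.finrank_mono hψ
      _ ≤ Module.finrank F (S → residueField j) := ψ.finrank_range_le
      _ = S.card * Module.finrank F R := by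
        rw [Module.finrank_pi_fintype, Finset.sum_const, Finset.card_univ, Fintype.card_coe,
          smul_eq_mul, e.toLinearEquiv.finrank_eq]
  · have h1 := comm_coeff_toHahn (j (l σ)) (j (l σ)).toHahn.order x
    rw [(hS σ hσ).2, ← HahnSeries.leadingCoeff_eq] at h1
    exact h1

theorem exists_maximalSubfield_of_isCrossedProduct [Algebra.IsCentral F A]
    (hchar : ¬ ringChar F ∣ algebraDegree F A) (hε : Function.Surjective ε)
    (h : IsCrossedProduct (HahnSeries ε.ker F) (MalcevNeumann U ε)) :
    ∃ M : Subalgebra F A, IsMaximalSubfield M ∧ ι.range ≤ M ∧ IsGaloisExtension F M := by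
  obtain ⟨L', hmax, hgal⟩ := h
  obtain ⟨L, _, _, _, ⟨f⟩⟩ := hgal.exists_field_algEquiv
  have := finiteDimensional (U := U) hε
  have : FiniteDimensional (HahnSeries ε.ker F) L := f.symm.toLinearEquiv.finiteDimensional
  let j : L →ₐ[HahnSeries ε.ker F] MalcevNeumann U ε := L'.val.comp f.toAlgHom
  have hj : j.range = L' := Subalgebra.range_val_comp_algEquiv f
  have hdim := finrank_le_sq_of_isMaximalCommutative j hε (hj.symm ▸ hmax)
  obtain ⟨R, _, _, ⟨e⟩⟩ :=
    (Subalgebra.isField_of_commute (residueField_commute j)).exists_field_algEquiv (F := F)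
  have hRn := normal_residueField j hε e
  have hcomm : ∀ x ∈ ι.range ⊔ residueField j, ∀ y ∈ ι.range ⊔ residueField j,
      x * y = y * x := by
    have hgen : ∀ x ∈ (ι.range : Set A) ∪ residueField j,
        ∀ y ∈ (ι.range : Set A) ∪ residueField j, x * y = y * x := by
      rintro x (⟨x, rfl⟩ | hx) y (⟨y, rfl⟩ | hy)
      · change ι x * ι y = ι y * ι x
        rw [← map_mul, mul_comm, map_mul]
      · exact comm_of_mem_residueField j hy x
      · exact (comm_of_mem_residueField j hx y).symm
      · exact residueField_commute j x hx y hy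
    intro x hx y hy
    have hadj := Algebra.isMulCommutative_adjoin F hgen
    rw [Algebra.adjoin_union, Algebra.adjoin_eq, Algebra.adjoin_eq] at hadj
    exact congrArg Subtype.val
      (hadj.is_comm.comm (⟨x, hx⟩ : (ι.range ⊔ residueField j : Subalgebra F A)) ⟨y, hy⟩)
  obtain ⟨M, _, _, ⟨g⟩⟩ := (Subalgebra.isField_of_commute hcomm).exists_field_algEquiv (F := F)
  let μ : M →ₐ[F] A := (ι.range ⊔ residueField j).val.comp g.toAlgHom
  have hμ : μ.range = ι.range ⊔ residueField j := Subalgebra.range_val_comp_algEquiv g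
  have hLM := finrank_le_of_range_eq_sup hε j e hμ
  have hMA : Module.finrank F A ≤ Module.finrank F M ^ 2 :=
    hdim.trans (Nat.pow_le_pow_left hLM 2)
  have hsq : Module.finrank F A = Module.finrank F M ^ 2 :=
    le_antisymm hMA (finrank_sq_le_of_algHom μ)
  have : FiniteDimensional F M :=
    FiniteDimensional.of_injective μ.toLinearMap μ.toRingHom.injective
  -- The degree of A is now [M:F], so the characteristic hypothesis applies to M.
  rw [algebraDegree, hsq, Nat.sqrt_eq'] at hchar
  have hsep := Algebra.isSeparable_of_not_ringChar_dvd_finrank hchar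
  have he : ((residueField j).val.comp e.toAlgHom).range = residueField j :=
    Subalgebra.range_val_comp_algEquiv e
  have hnorm : Normal F M := normal_of_range_eq_sup
    (e := (residueField j).val.comp e.toAlgHom) (he.symm ▸ hμ)
  have : IsGalois F M := ⟨⟩
  exact ⟨μ.range, IsMaximalSubfield.of_finrank_sq μ hMA, hμ ▸ le_sup_left,
    IsGaloisExtension.of_algEquiv (AlgEquiv.ofInjective μ μ.toRingHom.injective)⟩

end MalcevNeumann

theorem ConjugatingUnits.nonempty {F A K : Type*} [Field F] [DivisionRing A] [Algebra F A]
    [Algebra.IsCentral F A] [Field K] [Algebra F K] [FiniteDimensional F K] [IsGalois F K]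
    (ι : K →ₐ[F] A) : Nonempty (ConjugatingUnits ι) := by
  classical
  choose u hu using exists_unit_conj_eq ι
  -- Skolem-Noether gives some unit for the identity; it is replaced by 1 to normalize the family.
  refine ⟨⟨fun σ => if σ = 1 then 1 else u σ, fun σ x => ?_, if_pos rfl⟩⟩
  split_ifs with h
  · simp [h]
  · exact hu σ x

theorem corollary1p6 {F A K Γ : Type*} [Field F] [DivisionRing A] [Algebra F A]
    [Algebra.IsCentral F A] [FiniteDimensional F A]
    (hchar : ¬ ringChar F ∣ algebraDegree F A)
    [Field K] [Algebra F K] [IsGalois F K] [IsMulCommutative Gal(K/F)] (ι : K →ₐ[F] A)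
    [AddCommGroup Γ] [LinearOrder Γ] [IsOrderedAddMonoid Γ]
    (ε : Γ →+ Additive Gal(K/F)) (hε : Function.Surjective ε)
    (hA : ¬ ∃ M : Subalgebra F A, IsMaximalSubfield M ∧ ι.range ≤ M ∧ IsGaloisExtension F M) :
    Nonempty (ConjugatingUnits ι) ∧
      ∀ U : ConjugatingUnits ι,
        IsNoncrossedProductDivisionAlgebra (HahnSeries ε.ker F) (MalcevNeumann U ε) := by
  have : FiniteDimensional F K :=
    FiniteDimensional.of_injective ι.toLinearMap ι.toRingHom.injective
  refine ⟨ConjugatingUnits.nonempty ι, fun U => ?_⟩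
  have hfin := MalcevNeumann.finiteDimensional (U := U) hε
  exact
    { nontrivial := inferInstance
      isUnit_of_ne_zero := fun x hx => FiniteDimensional.isUnit (HahnSeries ε.ker F) hx
      isCentral := MalcevNeumann.isCentral hε
      finiteDimensional := hfin
      not_isCrossedProduct := fun h =>
        hA (MalcevNeumann.exists_maximalSubfield_of_isCrossedProduct hchar hε h) }
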